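/- Let $G=(V,E,w)$ be a finite simple undirected graph with nonnegative rational vertex weights $w_v$ and maximum degree $\Delta$; for $S\subseteq V$ put $w(S)=\sum_{v\in S}w_v$. A $k$-coloring of $G$ is a partition $(C_1,\dots,C_k)$ of $V$ into $k$ (possibly empty) independent sets. For $\alpha\ge 1$ it is called $\alpha$-EQ1 ($\alpha$-equitable up to one vertex) if for all $i,j\in\{1,\dots,k\}$ with $C_i\neq\emptyset$ there is a vertex $\bar v\in C_i$ with $w(C_i\setminus\{\bar v\})\le\alpha\,w(C_j)$. **Theorem.** Let $\varepsilon\in(0,0.1]$ be real and let $k\ge 1$ be an integer with $$k\;\ge\;\frac{4(1+\varepsilon)^2}{\varepsilon^2}\Bigl(\ln\frac1\varepsilon+4\Bigr)\Delta .$$ Then $G$ has a $(1+3\varepsilon)$-EQ1 $k$-coloring. Moreover, such a coloring can be computed in polynomial time: there is one deterministic algorithm which, given $G$, $w$, $k$ and a rational $\varepsilon$ satisfying these conditions, outputs a $(1+3\varepsilon)$-EQ1 $k$-coloring of $G$ in time polynomial in the length of the input, where the graph is given by its adjacency matrix and all numbers are written in binary. -/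

import Mathlib

/-! ## Weighted graphs and colorings that are equitable up to one vertex -/

namespace WeightedColoring

/-- The total weight `w(S)` of a set of vertices. -/
def weight {V : Type*} (w : V → ℚ) (S : Finset V) : ℚ := ∑ v ∈ S, w v

/-- The `i`-th color class `C_i` of a `k`-coloring; it may be empty. -/
def colorClass {V : Type*} [Fintype V] {G : SimpleGraph V} {k : ℕ}
    (c : G.Coloring (Fin k)) (i : Fin k) : Finset V :=
  Finset.univ.filter (fun v => c v = i)

/-- `α`-equitability up to one vertex: for all colors `i`, `j` with `C_i` nonempty there is a vertex
`v` of `C_i` such that `w(C_i \ {v}) ≤ α * w(C_j)`. -/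
def IsEQ1 {V : Type*} [Fintype V] [DecidableEq V] {G : SimpleGraph V} {k : ℕ}
    (w : V → ℚ) (α : ℝ) (c : G.Coloring (Fin k)) : Prop :=
  ∀ i j : Fin k, (colorClass c i).Nonempty →
    ∃ v ∈ colorClass c i,
      ((weight w ((colorClass c i).erase v) : ℚ) : ℝ) ≤ α * ((weight w (colorClass c j) : ℚ) : ℝ)

end WeightedColoring

/-! ## A machine model with a step count

Programs of a small imperative-functional language act on finite binary trees whose leaves are
natural numbers written in binary. A program is a finite syntax tree, independent of its input.
The cost is the logarithmic (bit) cost: each basic operation is charged the bit size of its operand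
plus the bit size of its result, and every test, iteration and copy is charged as well. Each basic
operation can be carried out by a Turing machine in time polynomial in its charge, and a Turing
machine can be simulated step by step (tapes are lists), so polynomial time in this model is the
usual polynomial time. -/

namespace CostModel

/-- Data: binary trees with natural numbers at the leaves. -/
inductive Data : Type
  | num (n : ℕ) : Data
  | pair (a b : Data) : Data

namespace Data

/-- Bit size: one unit for each node, plus the binary length of the number at each leaf. -/
def size : Data → ℕ
  | num n => Nat.size n + 1
  | pair a b => a.size + b.size + 1

/-- Lists as data: the empty list is the number `0`, and `a :: l` is the pair of `a` and `l`. -/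
def ofList : List Data → Data
  | [] => num 0
  | a :: l => pair a (ofList l)

end Data

/-- Basic operations: the identity, numerical constants, the two projections, the test for being a
number, and arithmetic and comparison of two natural numbers. -/
inductive Prim : Type
  | ident : Prim
  | const (n : ℕ) : Prim
  | fst : Prim
  | snd : Prim
  | isNum : Prim
  | add : Prim
  | sub : Prim
  | mul : Prim
  | div : Prim
  | le : Prim

/-- The result of a basic operation; on an operand of the wrong shape it is the number `0`.
Subtraction is truncated, division is rounded down (and division by `0` gives `0`), and tests
return `1` for true and `0` for false. -/
def Prim.apply : Prim → Data → Data
  | .ident, x => x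
  | .const n, _ => .num n
  | .fst, .pair a _ => a
  | .snd, .pair _ b => b
  | .isNum, .num _ => .num 1
  | .add, .pair (.num a) (.num b) => .num (a + b)
  | .sub, .pair (.num a) (.num b) => .num (a - b)
  | .mul, .pair (.num a) (.num b) => .num (a * b)
  | .div, .pair (.num a) (.num b) => .num (a / b)
  | .le, .pair (.num a) (.num b) => if a ≤ b then .num 1 else .num 0
  | _, _ => .num 0

/-- Programs: basic operations, pairing, sequencing (`seq p q` runs `p`, then `q` on its result),
branching (`branch c p q` runs `p` if the test `c` gives a result other than `0`, and `q`
otherwise) and while loops (`loop c p` repeats `p` as long as the test `c` gives a result other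
than `0`). -/
inductive Prog : Type
  | prim (o : Prim) : Prog
  | both (p q : Prog) : Prog
  | seq (p q : Prog) : Prog
  | branch (c p q : Prog) : Prog
  | loop (c p : Prog) : Prog

/-- `Runs p x y t`: on input `x` the program `p` halts with output `y`, at total cost `t`. -/
inductive Runs : Prog → Data → Data → ℕ → Prop
  | prim (o : Prim) (x : Data) :
      Runs (.prim o) x (o.apply x) (x.size + (o.apply x).size)
  | both {p q : Prog} {x a b : Data} {s t : ℕ} :
      Runs p x a s → Runs q x b t →
      Runs (.both p q) x (.pair a b) (s + t + x.size + (Data.pair a b).size)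
  | seq {p q : Prog} {x y z : Data} {s t : ℕ} :
      Runs p x y s → Runs q y z t →
      Runs (.seq p q) x z (s + t + 1)
  | branch_true {c p q : Prog} {x b y : Data} {s t : ℕ} :
      Runs c x b s → b ≠ .num 0 → Runs p x y t →
      Runs (.branch c p q) x y (s + t + x.size)
  | branch_false {c p q : Prog} {x y : Data} {s t : ℕ} :
      Runs c x (.num 0) s → Runs q x y t →
      Runs (.branch c p q) x y (s + t + x.size)
  | loop_stop {c p : Prog} {x : Data} {s : ℕ} :
      Runs c x (.num 0) s →
      Runs (.loop c p) x x (s + x.size)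
  | loop_step {c p : Prog} {x b y z : Data} {s t u : ℕ} :
      Runs c x b s → b ≠ .num 0 → Runs p x y t → Runs (.loop c p) y z u →
      Runs (.loop c p) x z (s + t + u + x.size)

/-- A nonnegative rational number, as the pair of its numerator and its denominator in lowest
terms. -/
def encodeRat (q : ℚ) : Data := .pair (.num q.num.toNat) (.num q.den)

/-- A function on `{0, …, n - 1}`, as the list of its values. -/
def encodeFun {n : ℕ} (f : Fin n → Data) : Data := Data.ofList (List.ofFn f)

/-- The input of the algorithm: the list of the number of vertices, the adjacency matrix (by rows),
the vertex weights, the number of colors and the accuracy parameter, all numbers in binary. -/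
def encodeInstance {n : ℕ} (G : SimpleGraph (Fin n)) [DecidableRel G.Adj] (w : Fin n → ℚ)
    (k : ℕ) (ε : ℚ) : Data :=
  Data.ofList
    [.num n,
     encodeFun (fun u => encodeFun (fun v => if G.Adj u v then .num 1 else .num 0)),
     encodeFun (fun v => encodeRat (w v)),
     .num k,
     encodeRat ε]

/-- The output of the algorithm: the list of the colors of the vertices. -/
def encodeColoring {n k : ℕ} {G : SimpleGraph (Fin n)} (c : G.Coloring (Fin k)) : Data :=
  encodeFun (fun v => .num (c v : ℕ))

end CostModel

/-! Write D for the maximum degree and take an integer T with 1/ε ≤ T ≤ 1/ε + 1. Order the vertices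
by decreasing weight and cut the first T·k positions into T blocks of k consecutive vertices. A
coloring is kept proper with no color repeated inside a block, so a complete block shows every color
once. Since (T+1)D < k, a vertex of a block that has no admissible color can take the color of an
earlier vertex of its block, which moves to a color missing in the block (`exists_swap`). Every
later vertex gets a color of least load among those not on its neighbors; the load of a color is its
weight outside the first block.

Fix colors h and j. Inside the blocks, the vertex of color h in block b+1 is no heavier than the one
of color j in block b, so load(h) ≤ total(j) (`load_le_total_of_le`). Suppose later that m gets
color h. If color j was free for m, then load(h) ≤ load(j) before the step, and the vertex of color
j in the first block pays for m. Otherwise m is charged to an earlier, at least as heavy neighbor of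
color j. Thus load(h) ≤ total(j) + blocked(h,j), and the blocked weights sum over h to at most
D·total(j) (`sum_blocked_le`).

Averaging over the at least k−D colors free at m, the least load is at most k/(k−D)·total(j)
(`mul_load_le`). The new weight is at most total(j)/T, because color j has a vertex in each block
(`mul_le_total`). Hence load(h) ≤ (k/(k−D) + 1/T)·total(j) always, and the factor is at most 1+3ε
(`ratio_le`). Deleting the first-block vertex of a color class leaves exactly its load, which gives
EQ1.

The algorithm runs this procedure on lists. Polynomial time follows from closure properties of
`PolyTime`; the delicate points are the sizes of fold accumulators and the fact that k, written in
binary, may be exponentially large. In particular n ≤ k is handled by giving all vertices different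
colors. -/

namespace CostModel

/-! ## Polynomial-time functions between encoded types -/

/-- Types whose elements are represented by data. -/
class Enc (α : Type) where
  /-- The representation. -/
  enc : α → Data

open Enc

instance : Enc ℕ := ⟨.num⟩

instance : Enc Bool := ⟨fun b => .num (if b then 1 else 0)⟩

instance : Enc Unit := ⟨fun _ => .num 0⟩

instance {α β : Type} [Enc α] [Enc β] : Enc (α × β) := ⟨fun x => .pair (enc x.1) (enc x.2)⟩

instance {α : Type} [Enc α] : Enc (List α) := ⟨fun l => Data.ofList (l.map enc)⟩

/-- The size of the representation. -/
def esize {α : Type} [Enc α] (x : α) : ℕ := (enc x).size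

section Encodings

variable {α β : Type} [Enc α] [Enc β]

theorem enc_bool (b : Bool) : enc b = Data.num (if b then 1 else 0) := rfl

theorem enc_pair (a : α) (b : β) : enc (a, b) = Data.pair (enc a) (enc b) := rfl

theorem enc_nil : enc ([] : List α) = Data.num 0 := rfl

theorem esize_nat (n : ℕ) : esize n = Nat.size n + 1 := rfl

theorem esize_bool_le (b : Bool) : esize b ≤ 2 := by
  cases b <;> simp [esize, enc_bool, Data.size]

theorem esize_pair (a : α) (b : β) : esize (a, b) = esize a + esize b + 1 := rfl

theorem esize_prod (x : α × β) : esize x = esize x.1 + esize x.2 + 1 := rfl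

theorem esize_nil : esize ([] : List α) = 1 := by simp [esize, enc_nil, Data.size]

theorem esize_cons (a : α) (l : List α) : esize (a :: l) = esize a + esize l + 1 := rfl

theorem length_le_esize (l : List α) : l.length ≤ esize l := by
  induction l with
  | nil => simp
  | cons a l ih => simp only [List.length_cons, esize_cons]; omega

theorem esize_le_of_mem {a : α} {l : List α} (h : a ∈ l) : esize a ≤ esize l := by
  induction l with
  | nil => simp at h
  | cons b l ih =>
    rw [esize_cons]
    rcases List.mem_cons.1 h with rfl | h
    · omega
    · have := ih h; omega

theorem esize_append (l m : List α) : esize (l ++ m) + 1 = esize l + esize m := by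
  induction l with
  | nil => simp [esize_nil, add_comm]
  | cons a l ih => simp only [List.cons_append, esize_cons]; omega

theorem esize_list_le {l : List α} {B : ℕ} (h : ∀ a ∈ l, esize a ≤ B) :
    esize l ≤ l.length * (B + 1) + 1 := by
  induction l with
  | nil => simp [esize_nil]
  | cons a l ih =>
    have h1 := h a (by simp)
    have h2 := ih fun b hb => h b (by simp [hb])
    rw [esize_cons, List.length_cons, add_mul]
    omega

/-- Splitting a list costs only one additional terminator; this controls the growth of insertion
sort. -/
theorem esize_filter_add_le (p : α → Bool) (l : List α) :
    esize (l.filter p) + esize (l.filter fun a => !p a) ≤ esize l + 1 := by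
  induction l with
  | nil => simp [esize_nil]
  | cons a l ih =>
    cases h : p a <;> simp only [List.filter_cons, h, esize_cons, Bool.not_true, Bool.not_false,
      if_true, Bool.false_eq_true, if_false] <;> omega

end Encodings

/-- Every rule charges for its result, directly or through a subrun. Hence a polynomial time bound
is also a bound on intermediate data, which is what composition needs. -/
theorem Runs.size_le {p : Prog} {x y : Data} {t : ℕ} (h : Runs p x y t) : y.size ≤ t := by
  induction h <;> omega

theorem eval_le_eval (P : Polynomial ℕ) {m n : ℕ} (h : m ≤ n) : P.eval m ≤ P.eval n := by
  rw [Polynomial.eval_eq_sum_range, Polynomial.eval_eq_sum_range]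
  gcongr

/-- `f` is computed by a program in time polynomial in the size of the argument. -/
def PolyTime {α β : Type} [Enc α] [Enc β] (f : α → β) : Prop :=
  ∃ (p : Prog) (P : Polynomial ℕ), ∀ x, ∃ t, Runs p (enc x) (enc (f x)) t ∧ t ≤ P.eval (esize x)

namespace PolyTime

variable {α β γ σ : Type} [Enc α] [Enc β] [Enc γ] [Enc σ]

theorem esize_le {f : α → β} (hf : PolyTime f) :
    ∃ P : Polynomial ℕ, ∀ x, esize (f x) ≤ P.eval (esize x) := by
  obtain ⟨p, P, h⟩ := hf
  refine ⟨P, fun x => ?_⟩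
  obtain ⟨t, ht, hP⟩ := h x
  exact ht.size_le.trans hP

theorem of_prim {f : α → β} (o : Prim) (Q : Polynomial ℕ) (h : ∀ x, o.apply (enc x) = enc (f x))
    (hQ : ∀ x, esize (f x) ≤ Q.eval (esize x)) : PolyTime f := by
  refine ⟨.prim o, Polynomial.X + Q, fun x => ⟨_, h x ▸ Runs.prim o (enc x), ?_⟩⟩
  rw [Polynomial.eval_add, Polynomial.eval_X]
  exact Nat.add_le_add_left (hQ x) _

theorem comp {g : β → γ} {f : α → β} (hg : PolyTime g) (hf : PolyTime f) :
    PolyTime fun x => g (f x) := by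
  obtain ⟨p, P, hp⟩ := hf
  obtain ⟨q, Q, hq⟩ := hg
  refine ⟨.seq p q, P + Q.comp P + 1, fun x => ?_⟩
  obtain ⟨s, hs, hsP⟩ := hp x
  obtain ⟨t, ht, htQ⟩ := hq (f x)
  refine ⟨_, .seq hs ht, ?_⟩
  have := htQ.trans (eval_le_eval Q (hs.size_le.trans hsP))
  simp only [Polynomial.eval_add, Polynomial.eval_comp, Polynomial.eval_one]
  omega

theorem pair {f : α → β} {g : α → γ} (hf : PolyTime f) (hg : PolyTime g) :
    PolyTime fun x => (f x, g x) := by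
  obtain ⟨p, P, hp⟩ := hf
  obtain ⟨q, Q, hq⟩ := hg
  refine ⟨.both p q, 2 * P + 2 * Q + Polynomial.X + 1, fun x => ?_⟩
  obtain ⟨s, hs, hsP⟩ := hp x
  obtain ⟨t, ht, htQ⟩ := hq x
  refine ⟨_, .both hs ht, ?_⟩
  have h1 := hs.size_le
  have h2 := ht.size_le
  simp only [Polynomial.eval_add, Polynomial.eval_mul, Polynomial.eval_ofNat, Polynomial.eval_X,
    Polynomial.eval_one, Data.size]
  change _ ≤ 2 * _ + 2 * _ + (enc x).size + 1
  omega

theorem ite {c : α → Bool} {f g : α → β} (hc : PolyTime c) (hf : PolyTime f) (hg : PolyTime g) :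
    PolyTime fun x => if c x then f x else g x := by
  obtain ⟨r, R, hr⟩ := hc
  obtain ⟨p, P, hp⟩ := hf
  obtain ⟨q, Q, hq⟩ := hg
  refine ⟨.branch r p q, R + P + Q + Polynomial.X, fun x => ?_⟩
  obtain ⟨u, hu, huR⟩ := hr x
  obtain ⟨s, hs, hsP⟩ := hp x
  obtain ⟨t, ht, htQ⟩ := hq x
  simp only [Polynomial.eval_add, Polynomial.eval_X]
  cases hcx : c x
  · rw [hcx] at hu
    refine ⟨_, .branch_false hu (by simpa using ht), ?_⟩
    change _ ≤ _ + (enc x).size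
    omega
  · rw [hcx] at hu
    refine ⟨_, .branch_true hu (by simp [enc_bool]) (by simpa using hs), ?_⟩
    change _ ≤ _ + (enc x).size
    omega

theorem id : PolyTime fun x : α => x :=
  of_prim .ident Polynomial.X (fun _ => rfl) fun x => by simp

theorem fst_apply : PolyTime (Prod.fst : α × β → α) :=
  of_prim .fst Polynomial.X (fun _ => rfl) fun x => by simp [esize_prod]; omega

theorem snd_apply : PolyTime (Prod.snd : α × β → β) :=
  of_prim .snd Polynomial.X (fun _ => rfl) fun x => by simp [esize_prod]; omega

theorem fst {f : α → β × γ} (hf : PolyTime f) : PolyTime fun x => (f x).1 := fst_apply.comp hf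

theorem snd {f : α → β × γ} (hf : PolyTime f) : PolyTime fun x => (f x).2 := snd_apply.comp hf

theorem const_nat (n : ℕ) : PolyTime fun _ : α => n :=
  of_prim (.const n) (Polynomial.C (n.size + 1)) (fun _ => rfl) fun x => by simp [esize_nat]

theorem const_bool (b : Bool) : PolyTime fun _ : α => b :=
  of_prim (.const (if b then 1 else 0)) (Polynomial.C 2) (fun _ => rfl) fun x => by
    simpa using esize_bool_le b

theorem const_nil : PolyTime fun _ : α => ([] : List β) :=
  of_prim (.const 0) (Polynomial.C 1) (fun _ => rfl) fun x => by simp [esize_nil]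

theorem cons {f : α → β} {g : α → List β} (hf : PolyTime f) (hg : PolyTime g) :
    PolyTime fun x => f x :: g x := hf.pair hg

theorem isEmpty {l : α → List β} (hl : PolyTime l) : PolyTime fun x => (l x).isEmpty := by
  refine comp (g := fun l : List β => l.isEmpty)
    (of_prim .isNum (Polynomial.C 2) (fun l => ?_) fun l => ?_) hl
  · cases l <;> rfl
  · simpa using esize_bool_le _

theorem size_add_le (a b : ℕ) : Nat.size (a + b) ≤ Nat.size a + Nat.size b + 1 := by
  rw [Nat.size_le]
  have h1 := Nat.lt_size_self a
  have h2 := Nat.lt_size_self b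
  have h3 : 2 ^ a.size ≤ 2 ^ (a.size + b.size) := Nat.pow_le_pow_right (by omega) (by omega)
  have h4 : 2 ^ b.size ≤ 2 ^ (a.size + b.size) := Nat.pow_le_pow_right (by omega) (by omega)
  rw [pow_succ]
  omega

theorem size_mul_le (a b : ℕ) : Nat.size (a * b) ≤ Nat.size a + Nat.size b := by
  rw [Nat.size_le, pow_add]
  exact Nat.mul_lt_mul'' (Nat.lt_size_self a) (Nat.lt_size_self b)

theorem binary {f g : α → ℕ} (hf : PolyTime f) (hg : PolyTime g) (o : Prim) (op : ℕ → ℕ → ℕ)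
    (h : ∀ a b, o.apply (.pair (.num a) (.num b)) = .num (op a b))
    (hs : ∀ a b, Nat.size (op a b) ≤ Nat.size a + Nat.size b + 1) :
    PolyTime fun x => op (f x) (g x) :=
  comp (g := fun x : ℕ × ℕ => op x.1 x.2) (of_prim o Polynomial.X (fun x => h x.1 x.2) fun x => by
    have := hs x.1 x.2
    simp only [esize_prod, esize_nat, Polynomial.eval_X]
    omega) (hf.pair hg)

theorem add {f g : α → ℕ} (hf : PolyTime f) (hg : PolyTime g) : PolyTime fun x => f x + g x :=
  binary hf hg .add (· + ·) (fun _ _ => rfl) size_add_le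

theorem sub {f g : α → ℕ} (hf : PolyTime f) (hg : PolyTime g) : PolyTime fun x => f x - g x :=
  binary hf hg .sub (· - ·) (fun _ _ => rfl) fun a b => by
    have := Nat.size_le_size (Nat.sub_le a b)
    omega

theorem mul {f g : α → ℕ} (hf : PolyTime f) (hg : PolyTime g) : PolyTime fun x => f x * g x :=
  binary hf hg .mul (· * ·) (fun _ _ => rfl) fun a b => by
    have := size_mul_le a b
    omega

theorem div {f g : α → ℕ} (hf : PolyTime f) (hg : PolyTime g) : PolyTime fun x => f x / g x :=
  binary hf hg .div (· / ·) (fun _ _ => rfl) fun a b => by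
    have := Nat.size_le_size (Nat.div_le_self a b)
    omega

theorem le {f g : α → ℕ} (hf : PolyTime f) (hg : PolyTime g) :
    PolyTime fun x => decide (f x ≤ g x) :=
  comp (g := fun x : ℕ × ℕ => decide (x.1 ≤ x.2))
    (of_prim .le (Polynomial.C 2)
      (fun x => by by_cases h : x.1 ≤ x.2 <;> simp [enc, Prim.apply, h])
      fun x => by simpa using esize_bool_le _) (hf.pair hg)

theorem not {f : α → Bool} (hf : PolyTime f) : PolyTime fun x => !f x := by
  convert hf.ite (const_bool false) (const_bool true) using 2 with x
  cases f x <;> rfl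

theorem and {f g : α → Bool} (hf : PolyTime f) (hg : PolyTime g) :
    PolyTime fun x => f x && g x := by
  convert hf.ite hg (const_bool false) using 2 with x
  cases f x <;> rfl

theorem or {f g : α → Bool} (hf : PolyTime f) (hg : PolyTime g) :
    PolyTime fun x => f x || g x := by
  convert hf.ite (const_bool true) hg using 2 with x
  cases f x <;> rfl

theorem lt {f g : α → ℕ} (hf : PolyTime f) (hg : PolyTime g) :
    PolyTime fun x => decide (f x < g x) := by
  convert (le hg hf).not using 2 with x
  rw [← decide_not, decide_eq_decide]
  omega

theorem eq {f g : α → ℕ} (hf : PolyTime f) (hg : PolyTime g) :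
    PolyTime fun x => decide (f x = g x) := by
  convert (le hf hg).and (le hg hf) using 2 with x
  rw [← Bool.decide_and, decide_eq_decide]
  omega

/-- A nonempty list is a pair whose first projection is the head; the branch is needed because `fst`
of the empty list is `0`, not the prescribed default. -/
theorem headD {l : α → List β} {d : α → β} (hl : PolyTime l) (hd : PolyTime d) :
    PolyTime fun x => (l x).headD (d x) := by
  obtain ⟨r, R, hr⟩ := hl.isEmpty
  obtain ⟨p, P, hp⟩ := hl
  obtain ⟨q, Q, hq⟩ := hd
  refine ⟨.branch r q (.seq p (.prim .fst)), R + 3 * P + Q + Polynomial.X + 1, fun x => ?_⟩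
  obtain ⟨u, hu, huR⟩ := hr x
  obtain ⟨s, hs, hsP⟩ := hp x
  obtain ⟨t, ht, htQ⟩ := hq x
  simp only [Polynomial.eval_add, Polynomial.eval_X, Polynomial.eval_mul, Polynomial.eval_ofNat,
    Polynomial.eval_one]
  cases hlx : l x with
  | nil =>
    simp only [hlx] at hu
    refine ⟨_, .branch_true hu (by simp [enc_bool]) ht, ?_⟩
    change _ ≤ _ + (enc x).size + 1
    omega
  | cons a m =>
    simp only [hlx] at hu hs
    refine ⟨_, .branch_false hu (.seq hs (.prim .fst _)), ?_⟩
    have h1 := hs.size_le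
    have h2 : (Prim.fst.apply (enc (a :: m))).size ≤ (enc (a :: m)).size := by
      change (enc a).size ≤ (enc a).size + (enc m).size + 1
      omega
    change _ ≤ _ + (enc x).size + 1
    omega

end PolyTime

end CostModel

/-! ### Folds and list operations in polynomial time -/

namespace CostModel

open Enc

namespace PolyTime

variable {α β γ σ : Type} [Enc α] [Enc β] [Enc γ] [Enc σ]

/-- The loop carries the argument, the accumulator and the remaining list. Each round costs at most
a test, a body and a copy of this triple, so all accumulators along the way, the folds over
prefixes, must be bounded. -/
theorem runs_foldl {r b : Prog} {A B S N M : ℕ} {F : α → σ → β → σ} {x : α}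
    (hr : ∀ (s : σ) (l : List β), esize s ≤ S → esize l ≤ M →
      ∃ t, Runs r (enc (x, s, l)) (enc (!l.isEmpty)) t ∧ t ≤ A)
    (hb : ∀ (s : σ) (a : β) (l : List β), esize s ≤ S → esize (a :: l) ≤ M →
      ∃ t, Runs b (enc (x, s, a :: l)) (enc (x, F x s a, l)) t ∧ t ≤ B)
    (hx : esize x ≤ N) (l : List β) (s : σ) (hl : esize l ≤ M)
    (hs : ∀ l₁, l₁ <+: l → esize (l₁.foldl (F x) s) ≤ S) :
    ∃ t, Runs (.loop r b) (enc (x, s, l)) (enc (x, l.foldl (F x) s, ([] : List β))) t ∧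
      t ≤ (l.length + 1) * (A + B + (N + S + M + 2)) := by
  have hsize : ∀ (s : σ) (l : List β), esize s ≤ S → esize l ≤ M →
      (enc (x, s, l)).size ≤ N + S + M + 2 := by
    intro s l h1 h2
    change esize x + (esize s + esize l + 1) + 1 ≤ _
    omega
  induction l generalizing s with
  | nil =>
    have hs0 := hs [] (List.prefix_refl _)
    obtain ⟨t, ht, htA⟩ := hr s [] hs0 hl
    refine ⟨_, Runs.loop_stop ht, ?_⟩
    have := hsize s [] hs0 hl
    simp only [List.length_nil, zero_add, one_mul]
    omega
  | cons a l ih =>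
    have hs0 := hs [] (List.nil_prefix)
    have hl' : esize l ≤ M := by rw [esize_cons] at hl; omega
    obtain ⟨t, ht, htA⟩ := hr s (a :: l) hs0 hl
    obtain ⟨u, hu, huB⟩ := hb s a l hs0 hl
    obtain ⟨v, hv, hvC⟩ := ih (F x s a) hl' fun l₁ h₁ => by
      simpa using hs (a :: l₁) (List.cons_prefix_cons.2 ⟨rfl, h₁⟩)
    refine ⟨_, .loop_step ht (by simp [enc_bool]) hu hv, ?_⟩
    have := hsize s (a :: l) hs0 hl
    rw [List.length_cons, add_mul (l.length + 1), one_mul]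
    omega

/-- A polynomial-time step is not enough, since an accumulator that doubles its size in each round
becomes exponentially large; hence the separate bound `hQ`. -/
theorem foldl_of_bound {F : α → σ → β → σ} {I : α → σ} {L : α → List β}
    (hF : PolyTime fun p : (α × σ) × β => F p.1.1 p.1.2 p.2) (hI : PolyTime I) (hL : PolyTime L)
    (Q : Polynomial ℕ)
    (hQ : ∀ x l, l <+: L x → esize (l.foldl (F x) (I x)) ≤ Q.eval (esize x)) :
    PolyTime fun x => (L x).foldl (F x) (I x) := by
  have hr : PolyTime fun y : α × σ × List β => !y.2.2.isEmpty := id.snd.snd.isEmpty.not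
  have hb : PolyTime fun y : α × σ × β × List β => (y.1, F y.1 y.2.1 y.2.2.1, y.2.2.2) :=
    id.fst.pair ((hF.comp ((id.fst.pair id.snd.fst).pair id.snd.snd.fst)).pair id.snd.snd.snd)
  obtain ⟨r, R, hr⟩ := hr
  obtain ⟨b, B, hb⟩ := hb
  obtain ⟨pL, hpL⟩ := hL.esize_le
  have hloop : ∃ (p : Prog) (P : Polynomial ℕ), ∀ x : α, ∃ t,
      Runs p (enc (x, I x, L x)) (enc (x, (L x).foldl (F x) (I x), ([] : List β))) t ∧
        t ≤ P.eval (esize x) := by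
    let Z : Polynomial ℕ := Polynomial.X + Q + pL + 2
    refine ⟨.loop r b, (pL + 1) * (R.comp Z + B.comp Z + Z), fun x => ?_⟩
    have hZ : Z.eval (esize x) = esize x + Q.eval (esize x) + pL.eval (esize x) + 2 := by
      simp [Z]
    have hsz : ∀ (s : σ) (l : List β), esize s ≤ Q.eval (esize x) → esize l ≤ pL.eval (esize x) →
        esize (x, s, l) ≤ Z.eval (esize x) := by
      intro s l h1 h2
      rw [hZ, esize_pair, esize_pair]
      omega
    obtain ⟨t, ht, htle⟩ := runs_foldl (r := r) (b := b) (A := (R.comp Z).eval (esize x))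
      (B := (B.comp Z).eval (esize x)) (S := Q.eval (esize x)) (N := esize x)
      (M := pL.eval (esize x)) (F := F) (x := x)
      (fun s l h1 h2 => by
        obtain ⟨t, ht, hle⟩ := hr (x, s, l)
        refine ⟨t, ht, hle.trans ?_⟩
        rw [Polynomial.eval_comp]
        exact eval_le_eval _ (hsz s l h1 h2))
      (fun s a l h1 h2 => by
        obtain ⟨t, ht, hle⟩ := hb (x, s, a, l)
        refine ⟨t, ht, hle.trans ?_⟩
        rw [Polynomial.eval_comp]
        exact eval_le_eval _ (hsz s (a :: l) h1 h2))
      le_rfl (L x) (I x) (hpL x) (hQ x)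
    refine ⟨t, ht, htle.trans ?_⟩
    rw [Polynomial.eval_mul, Polynomial.eval_add, Polynomial.eval_add, Polynomial.eval_add,
      Polynomial.eval_one]
    refine Nat.mul_le_mul ?_ ?_
    · exact Nat.add_le_add_right ((length_le_esize _).trans (hpL x)) 1
    · rw [hZ]
  have hinit : PolyTime fun x : α => (x, I x, L x) := id.pair (hI.pair ?_)
  · obtain ⟨q, P, hq⟩ := hloop
    obtain ⟨q₀, P₀, hq₀⟩ := hinit
    -- The two projections extract the accumulator from the final triple. They handle four data of
    -- size at most the cost of the loop, whence the factor 5; the 3 counts the sequencings.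
    refine ⟨.seq q₀ (.seq q (.seq (.prim .snd) (.prim .fst))), P₀ + 5 * P + 3, fun x => ?_⟩
    obtain ⟨s, hs, hsP⟩ := hq₀ x
    obtain ⟨t, ht, htP⟩ := hq x
    refine ⟨_, .seq hs (.seq ht (.seq (.prim .snd _) (.prim .fst _))), ?_⟩
    have h1 := ht.size_le
    simp only [Polynomial.eval_add, Polynomial.eval_mul, Polynomial.eval_ofNat, enc_pair,
      Prim.apply, Data.size] at h1 ⊢
    omega
  · assumption

/-- The increment allowed in one round does not depend on the accumulator, so increments add up over
the list instead of compounding. -/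
theorem foldl_of_growth {F : α → σ → β → σ} {I : α → σ} {L : α → List β}
    (hF : PolyTime fun p : (α × σ) × β => F p.1.1 p.1.2 p.2) (hI : PolyTime I) (hL : PolyTime L)
    (Q : Polynomial ℕ)
    (hQ : ∀ x s a, esize (F x s a) ≤ esize s + Q.eval (esize x + esize a)) :
    PolyTime fun x => (L x).foldl (F x) (I x) := by
  obtain ⟨PI, hPI⟩ := hI.esize_le
  obtain ⟨PL, hPL⟩ := hL.esize_le
  refine foldl_of_bound hF hI hL (PI + PL * Q.comp (Polynomial.X + PL)) fun x l hl => ?_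
  have key : ∀ (m : List β) (s : σ) (Z : ℕ), (∀ a ∈ m, esize a ≤ Z) →
      esize (m.foldl (F x) s) ≤ esize s + m.length * Q.eval (esize x + Z) := by
    intro m
    induction m with
    | nil => simp
    | cons a m ih =>
      intro s Z h
      refine (ih (F x s a) Z fun b hb => h b (by simp [hb])).trans ?_
      have h1 := hQ x s a
      have h2 := eval_le_eval Q (Nat.add_le_add_left (h a (by simp)) (esize x))
      rw [List.length_cons, add_mul, one_mul]
      omega
  have hmem : ∀ a ∈ l, esize a ≤ PL.eval (esize x) := fun a ha =>
    (esize_le_of_mem (hl.subset ha)).trans (hPL x)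
  refine (key l (I x) _ hmem).trans ?_
  simp only [Polynomial.eval_add, Polynomial.eval_mul, Polynomial.eval_comp, Polynomial.eval_X]
  refine Nat.add_le_add (hPI x) (Nat.mul_le_mul_right _ ?_)
  exact hl.length_le.trans ((length_le_esize _).trans (hPL x))

theorem reverse {l : α → List β} (hl : PolyTime l) : PolyTime fun x => (l x).reverse := by
  convert foldl_of_growth (F := fun (_ : α) (s : List β) a => a :: s) (I := fun _ => [])
    (id.snd.cons id.fst.snd) const_nil hl (Polynomial.X + 1) ?_ using 2 with x
  · simp
  · intro x s a
    simp only [esize_cons, Polynomial.eval_add, Polynomial.eval_X, Polynomial.eval_one]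
    omega

theorem foldr_of_growth {F : α → β → σ → σ} {I : α → σ} {L : α → List β}
    (hF : PolyTime fun p : (α × σ) × β => F p.1.1 p.2 p.1.2) (hI : PolyTime I) (hL : PolyTime L)
    (Q : Polynomial ℕ)
    (hQ : ∀ x s a, esize (F x a s) ≤ esize s + Q.eval (esize x + esize a)) :
    PolyTime fun x => (L x).foldr (F x) (I x) := by
  convert foldl_of_growth (F := fun x s a => F x a s) hF hI hL.reverse Q hQ using 2 with x
  rw [List.foldl_reverse]

theorem map {l : α → List β} {f : α → β → γ} (hl : PolyTime l)
    (hf : PolyTime fun p : α × β => f p.1 p.2) : PolyTime fun x => (l x).map (f x) := by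
  obtain ⟨P, hP⟩ := hf.esize_le
  convert foldr_of_growth (F := fun x a (s : List γ) => f x a :: s) (I := fun _ => [])
    ((hf.comp (id.fst.fst.pair id.snd)).cons id.fst.snd) const_nil hl
    (P.comp (Polynomial.X + 1) + 1) ?_ using 2 with x
  · rw [List.map_eq_foldr]
  · intro x s a
    have := hP (x, a)
    simp only at this
    simp only [esize_cons, Polynomial.eval_add, Polynomial.eval_comp, Polynomial.eval_X,
      Polynomial.eval_one]
    rw [esize_pair] at this
    omega

theorem filter {l : α → List β} {f : α → β → Bool} (hl : PolyTime l)
    (hf : PolyTime fun p : α × β => f p.1 p.2) : PolyTime fun x => (l x).filter (f x) := by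
  convert foldr_of_growth (F := fun x a (s : List β) => if f x a then a :: s else s)
    (I := fun _ => [])
    ((hf.comp (id.fst.fst.pair id.snd)).ite (id.snd.cons id.fst.snd) id.fst.snd) const_nil hl
    (Polynomial.X + 1) ?_ using 2 with x
  · induction l x with
    | nil => rfl
    | cons a m ih => rw [List.filter_cons, List.foldr_cons, ih]
  · intro x s a
    simp only [Polynomial.eval_add, Polynomial.eval_X, Polynomial.eval_one]
    split
    · rw [esize_cons]; omega
    · omega

theorem all {l : α → List β} {f : α → β → Bool} (hl : PolyTime l)
    (hf : PolyTime fun p : α × β => f p.1 p.2) : PolyTime fun x => (l x).all (f x) := by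
  convert (hl.filter (f := fun x a => !f x a) hf.not).isEmpty using 2 with x
  induction l x with
  | nil => rfl
  | cons a m ih => cases h : f x a <;> simp [h, ih]

theorem append {l m : α → List β} (hl : PolyTime l) (hm : PolyTime m) :
    PolyTime fun x => l x ++ m x := by
  convert foldr_of_growth (F := fun _ a (s : List β) => a :: s)
    (id.snd.cons id.fst.snd) hm hl (Polynomial.X + 1) ?_ using 2 with x
  · simp
  · intro x s a
    simp only [esize_cons, Polynomial.eval_add, Polynomial.eval_X, Polynomial.eval_one]
    omega

theorem flatMap {l : α → List β} {f : α → β → List γ} (hl : PolyTime l)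
    (hf : PolyTime fun p : α × β => f p.1 p.2) : PolyTime fun x => (l x).flatMap (f x) := by
  obtain ⟨P, hP⟩ := hf.esize_le
  convert foldr_of_growth (F := fun x a (s : List γ) => f x a ++ s) (I := fun _ => [])
    ((hf.comp (id.fst.fst.pair id.snd)).append id.fst.snd) const_nil hl
    (P.comp (Polynomial.X + 1)) ?_ using 2 with x
  · induction l x with
    | nil => rfl
    | cons a m ih => rw [List.flatMap_cons, List.foldr_cons, ih]
  · intro x s a
    have h1 := hP (x, a)
    simp only at h1
    have h2 := esize_append (f x a) s
    simp only [Polynomial.eval_add, Polynomial.eval_comp, Polynomial.eval_X,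
      Polynomial.eval_one]
    rw [esize_pair] at h1
    omega

theorem sum {l : α → List ℕ} (hl : PolyTime l) : PolyTime fun x => (l x).sum := by
  convert foldr_of_growth (F := fun _ a (s : ℕ) => a + s) (I := fun _ => 0)
    (id.snd.add id.fst.snd) (const_nat 0) hl (Polynomial.X + 1) ?_ using 2 with x
  · rw [List.sum_eq_foldr]
  intro x s a
  have := size_add_le a s
  simp only [esize_nat, Polynomial.eval_add, Polynomial.eval_X, Polynomial.eval_one]
  omega

theorem prod {l : α → List ℕ} (hl : PolyTime l) : PolyTime fun x => (l x).prod := by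
  convert foldr_of_growth (F := fun _ a (s : ℕ) => a * s) (I := fun _ => 1)
    (id.snd.mul id.fst.snd) (const_nat 1) hl (Polynomial.X + 1) ?_ using 2 with x
  · rw [List.prod_eq_foldr]
  intro x s a
  have := size_mul_le a s
  simp only [esize_nat, Polynomial.eval_add, Polynomial.eval_X, Polynomial.eval_one]
  omega

/-- Indexing as a fold with a counter: once the counter has passed `i`, the stored value no longer
changes. -/
theorem foldl_getD_aux {τ : Type} (l : List τ) (i j : ℕ) (d : τ) (h : j ≤ i) :
    (l.foldl (fun (s : ℕ × τ) a => (s.1 + 1, if s.1 = i then a else s.2)) (j, d)).2 =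
      l.getD (i - j) d := by
  have past : ∀ (l : List τ) (j : ℕ) (d : τ), i < j →
      (l.foldl (fun (s : ℕ × τ) a => (s.1 + 1, if s.1 = i then a else s.2)) (j, d)).2 = d := by
    intro l
    induction l with
    | nil => simp
    | cons a l ih =>
      intro j d hj
      rw [List.foldl_cons, ih (j + 1) _ (by omega), if_neg (by simp only; omega)]
  induction l generalizing j with
  | nil => simp
  | cons a l ih =>
    rcases h.eq_or_lt with rfl | h
    · rw [List.foldl_cons, past _ _ _ (by simp)]
      simp
    · rw [List.foldl_cons, if_neg (by simp only; omega), ih (j + 1) h]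
      obtain ⟨e, rfl⟩ : ∃ e, i = j + e + 1 := ⟨i - j - 1, by omega⟩
      rw [show j + e + 1 - (j + 1) = e by omega, show j + e + 1 - j = e + 1 by omega]
      simp

theorem getD {l : α → List β} {i : α → ℕ} {d : α → β} (hl : PolyTime l) (hi : PolyTime i)
    (hd : PolyTime d) : PolyTime fun x => (l x).getD (i x) (d x) := by
  have key : PolyTime fun y : (List β × ℕ) × β => (y.1.1.foldl
      (fun (s : ℕ × β) a => (s.1 + 1, if decide (s.1 = y.1.2) then a else s.2)) (0, y.2)).2 := by
    refine (foldl_of_growth (F := fun (y : (List β × ℕ) × β) (s : ℕ × β) a =>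
      (s.1 + 1, if decide (s.1 = y.1.2) then a else s.2)) (I := fun y => (0, y.2)) ?_
      ((const_nat 0).pair id.snd) id.fst.fst (Polynomial.X + 2) ?_).snd
    · exact (id.fst.snd.fst.add (const_nat 1)).pair
        ((id.fst.snd.fst.eq id.fst.fst.fst.snd).ite id.snd id.fst.snd.snd)
    · intro x s a
      have h := size_add_le s.1 1
      rw [esize_pair, esize_prod s, esize_nat, esize_nat]
      rw [Nat.size_one] at h
      simp only [Polynomial.eval_add, Polynomial.eval_X, Polynomial.eval_ofNat]
      split <;> omega
  convert key.comp ((hl.pair hi).pair hd) using 2 with x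
  have := foldl_getD_aux (l x) (i x) 0 (d x) (Nat.zero_le _)
  simpa using this.symm

theorem foldl_range_aux {τ : Type} (l : List τ) (j : ℕ) (s : List ℕ) :
    (l.foldl (fun (s : ℕ × List ℕ) _ => (s.1 + 1, s.1 :: s.2)) (j, s)).2 =
      (List.range' j l.length).reverse ++ s := by
  induction l generalizing j s with
  | nil => simp
  | cons a l ih => rw [List.foldl_cons, ih, List.length_cons, List.range'_succ]; simp

/-- The range is that of a list length, since `List.range n` is exponentially long in the binary
size of `n`. The entry added in a round is the counter, a part of the accumulator, so
`foldl_of_growth` does not apply and a quadratic bound is proved directly. -/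
theorem range_length {l : α → List β} (hl : PolyTime l) :
    PolyTime fun x => List.range (l x).length := by
  obtain ⟨P, hP⟩ := hl.esize_le
  have hlen : ∀ (m : List β) (j : ℕ) (s : List ℕ),
      (m.foldl (fun (s : ℕ × List ℕ) _ => (s.1 + 1, s.1 :: s.2)) (j, s)).1 = j + m.length := by
    intro m
    induction m with
    | nil => simp
    | cons a m ih => intro j s; rw [List.foldl_cons, ih, List.length_cons]; omega
  have hsz : ∀ n : ℕ, Nat.size n ≤ n := fun n => Nat.size_le.2 (Nat.lt_two_pow_self)
  convert (foldl_of_bound (F := fun (_ : α) (s : ℕ × List ℕ) (_ : β) => (s.1 + 1, s.1 :: s.2))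
    (I := fun _ => (0, [])) ?_ ((const_nat 0).pair const_nil) hl
    (P + 1 + (P * (P + 2) + 1) + 1) ?_).snd.reverse using 2 with x
  · rw [foldl_range_aux, List.append_nil, List.reverse_reverse, List.range_eq_range']
  · exact (id.fst.snd.fst.add (const_nat 1)).pair (id.fst.snd.fst.cons id.fst.snd.snd)
  · intro x m hm
    have hmP : m.length ≤ P.eval (esize x) :=
      hm.length_le.trans ((length_le_esize _).trans (hP x))
    rw [esize_prod, hlen, foldl_range_aux, List.append_nil]
    have h1 : esize (List.range' 0 m.length).reverse ≤ m.length * (m.length + 1 + 1) + 1 := by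
      have := esize_list_le (l := (List.range' 0 m.length).reverse) (B := m.length + 1)
        fun a ha => by
          have hs := hsz a
          rw [List.mem_reverse, List.mem_range'_1] at ha
          rw [esize_nat]
          omega
      simpa using this
    have h2 := hsz (0 + m.length)
    have h3 : m.length * (m.length + 1 + 1) ≤ P.eval (esize x) * (P.eval (esize x) + 2) :=
      Nat.mul_le_mul hmP (by omega)
    simp only [esize_nat, Polynomial.eval_add, Polynomial.eval_mul, Polynomial.eval_one,
      Polynomial.eval_ofNat]
    omega

end PolyTime

end CostModel

/-! ## Colorings built block by block, then greedily

The vertices `0, …, n - 1` come in order of decreasing weight. Each of the first `T` blocks of `k`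
consecutive vertices is spread over all `k` colors; each later vertex gets a color of least load
among the colors that none of its neighbors has. -/

namespace BlockGreedy

open Finset

open scoped Classical

variable {n : ℕ} (G : SimpleGraph (Fin n)) (w : Fin n → ℕ) (k T : ℕ)

/-- The block of position `p`: positions from `T * k` on are blocks of their own. -/
def block (p : ℕ) : ℕ := if p < T * k then p / k else p

/-- Among the first `m` vertices, those of equal color are nonadjacent and in different blocks. -/
def Valid (col : Fin n → ℕ) (m : ℕ) : Prop :=
  ∀ a b : Fin n, (a : ℕ) < m → (b : ℕ) < m → a ≠ b → col a = col b →
    ¬ G.Adj a b ∧ block k T a ≠ block k T b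

/-- The weight of color `c` among the first `m` vertices. -/
noncomputable def total (col : Fin n → ℕ) (m c : ℕ) : ℕ :=
  ∑ a with col a = c ∧ (a : ℕ) < m, w a

/-- The weight of color `c` among the first `m` vertices, without the first block. -/
noncomputable def load (col : Fin n → ℕ) (m c : ℕ) : ℕ :=
  ∑ a with col a = c ∧ (a : ℕ) < m ∧ k ≤ (a : ℕ), w a

/-- The weight of the vertices of color `h` with an at least as heavy neighbor of color `j`. -/
noncomputable def blocked (col : Fin n → ℕ) (m h j : ℕ) : ℕ :=
  ∑ a with col a = h ∧ (a : ℕ) < m ∧ ∃ u, col u = j ∧ (u : ℕ) < m ∧ G.Adj a u ∧ w a ≤ w u, w a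

/-- Vertex `m` gets color `c`, which used to be the color of `u`, and `u` gets color `c`. -/
def swap (col : Fin n → ℕ) (m u : Fin n) (c : ℕ) : Fin n → ℕ :=
  Function.update (Function.update col m (col u)) u c

/-- One step of the algorithm: vertex `m` gets a valid color of least load if there is a valid
color, and otherwise takes over the color of an earlier vertex, which is recolored. -/
def Step (m : Fin n) (col col' : Fin n → ℕ) : Prop :=
  (∃ c < k, Valid G k T (Function.update col m c) (m + 1) ∧
    (∀ d < k, Valid G k T (Function.update col m d) (m + 1) → load w k col m c ≤ load w k col m d) ∧
    col' = Function.update col m c) ∨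
  ((∀ c < k, ¬ Valid G k T (Function.update col m c) (m + 1)) ∧
    ∃ c < k, ∃ u < m, Valid G k T (swap col m u c) (m + 1) ∧ col' = swap col m u c)

variable {G w k T} {col : Fin n → ℕ} {D : ℕ}

theorem block_of_lt {p : ℕ} (h : p < T * k) : block k T p = p / k := if_pos h

theorem block_of_le {p : ℕ} (h : T * k ≤ p) : block k T p = p := if_neg (by omega)

/-- A label never exceeds its position, so a late position shares its label with no earlier one. In
the greedy phase validity thus only excludes the colors of neighbors. -/
theorem block_ne_of_lt_of_le {p q : ℕ} (hp : p < q) (h : T * k ≤ q) :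
    block k T p ≠ block k T q := by
  rw [block_of_le h, block]
  split_ifs
  · exact ((Nat.div_le_self p k).trans_lt hp).ne
  · exact hp.ne

theorem valid_update {m : Fin n} {c : ℕ} (hv : Valid G k T col m)
    (h : ∀ x : Fin n, x < m → col x = c → ¬ G.Adj m x ∧ block k T m ≠ block k T x) :
    Valid G k T (Function.update col m c) (m + 1) := by
  intro a b ha hb hab hc
  rcases eq_or_ne a m with rfl | ham
  · have hbm : b < a := lt_of_le_of_ne (Nat.lt_succ_iff.1 hb) hab.symm
    rw [Function.update_self, Function.update_of_ne hab.symm] at hc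
    exact h b hbm hc.symm
  · have ham' : a < m := lt_of_le_of_ne (Nat.lt_succ_iff.1 ha) ham
    rw [Function.update_of_ne ham] at hc
    rcases eq_or_ne b m with rfl | hbm
    · rw [Function.update_self] at hc
      have := h a ham' hc
      exact ⟨fun h' => this.1 h'.symm, this.2.symm⟩
    · rw [Function.update_of_ne hbm] at hc
      exact hv a b ham' (Fin.lt_def.1 (lt_of_le_of_ne (Fin.le_def.2 (Nat.lt_succ_iff.1 hb)) hbm)) hab hc

/-- Before the swap `u` was the only vertex of its color in the block that it shares with `m`, so
the block condition is met when `m` inherits this color. -/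
theorem valid_swap {m u : Fin n} {c : ℕ} (hv : Valid G k T col m) (hum : u < m) (hc : col u ≠ c)
    (hblock : block k T u = block k T m)
    (hm : ∀ x < m, G.Adj m x → col x ≠ col u)
    (hu : ∀ x < m, col x = c → ¬ G.Adj u x ∧ block k T u ≠ block k T x) :
    Valid G k T (swap col m u c) (m + 1) := by
  have key : ∀ x < m, x ≠ u → col x = col u → ¬ G.Adj m x ∧ block k T m ≠ block k T x :=
    fun x hx hxu hxc => ⟨fun h => hm x hx h hxc, hblock ▸ (hv u x hum hx hxu.symm hxc.symm).2⟩
  have hlt : ∀ {x : Fin n}, (x : ℕ) < m + 1 → x ≠ m → x < m := fun h h' =>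
    lt_of_le_of_ne (Nat.lt_succ_iff.1 h) h'
  have vm : swap col m u c m = col u := by
    rw [swap, Function.update_of_ne hum.ne', Function.update_self]
  have vu : swap col m u c u = c := by rw [swap, Function.update_self]
  have vx : ∀ x, x ≠ m → x ≠ u → swap col m u c x = col x := fun x h1 h2 => by
    rw [swap, Function.update_of_ne h2, Function.update_of_ne h1]
  have half : ∀ a b : Fin n, (a : ℕ) < m + 1 → (b : ℕ) < m + 1 → a ≠ b → (a = m ∨ a = u) →
      swap col m u c a = swap col m u c b → ¬ G.Adj a b ∧ block k T a ≠ block k T b := by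
    intro a b _ hb hab ha hcol
    rcases ha with rfl | rfl
    · rw [vm] at hcol
      by_cases hbu : b = u
      · rw [hbu, vu] at hcol
        exact absurd hcol hc
      · rw [vx b hab.symm hbu] at hcol
        exact key b (hlt hb hab.symm) hbu hcol.symm
    · rw [vu] at hcol
      by_cases hbm : b = m
      · rw [hbm, vm] at hcol
        exact absurd hcol.symm hc
      · rw [vx b hbm hab.symm] at hcol
        exact hu b (hlt hb hbm) hcol.symm
  intro a b ha hb hab hcol
  by_cases ha' : a = m ∨ a = u
  · exact half a b ha hb hab ha' hcol
  by_cases hb' : b = m ∨ b = u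
  · have := half b a hb ha hab.symm hb' hcol.symm
    exact ⟨fun h => this.1 h.symm, this.2.symm⟩
  push Not at ha' hb'
  rw [vx a ha'.1 ha'.2, vx b hb'.1 hb'.2] at hcol
  exact hv a b (hlt ha ha'.1) (hlt hb hb'.1) hab hcol

/-- In the block phase, a vertex without valid color can swap colors with an earlier one. -/
theorem exists_swap {m : Fin n} (hD : ∀ v (s : Finset (Fin n)), (∀ u ∈ s, G.Adj v u) → #s ≤ D)
    (hk : (T + 1) * D < k) (hv : Valid G k T col m)
    (hno : ∀ c < k, ¬ Valid G k T (Function.update col m c) (m + 1)) :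
    ∃ c < k, ∃ u < m, Valid G k T (swap col m u c) (m + 1) := by
  have hk0 : 0 < k := by omega
  set N := univ.filter fun x : Fin n => x < m ∧ G.Adj m x with hN
  have hND : #N ≤ D := hD m N fun u hu => (mem_filter.1 hu).2.2
  have hDk : D < k := lt_of_le_of_lt (Nat.le_mul_of_pos_left D (by omega)) hk
  -- Beyond the blocks only neighbors exclude colors, and there are fewer than `k` of them.
  have hmT : (m : ℕ) < T * k := by
    by_contra hmT
    obtain ⟨c, hc, hcN⟩ := exists_mem_notMem_of_card_lt_card
      (s := N.image col) (t := range k) (by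
        rw [card_range]; exact card_image_le.trans_lt (hND.trans_lt hDk))
    refine hno c (mem_range.1 hc) (valid_update hv fun x hx hxc => ⟨fun h => hcN ?_, ?_⟩)
    · exact mem_image.2 ⟨x, by simp [hN, hx, h], hxc⟩
    · exact (block_ne_of_lt_of_le hx (not_lt.1 hmT)).symm
  have hbl : ∀ x : Fin n, x ≤ m → block k T x = x / k := fun x hx =>
    block_of_lt (lt_of_le_of_lt hx hmT)
  set g := (m : ℕ) / k with hg
  have hgT : g < T := (Nat.div_lt_iff_lt_mul hk0).2 hmT
  set R := univ.filter fun x : Fin n => x < m ∧ (x : ℕ) / k = g with hR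
  have hRk : #R < k := by
    have h1 : #R ≤ #(range (m % k)) := by
      refine card_le_card_of_injOn (fun x => (x : ℕ) % k) (fun x hx => ?_) fun x hx y hy hxy => ?_
      · obtain ⟨-, h1, h2⟩ := mem_filter.1 hx
        have h3 := Nat.div_add_mod x k
        have h4 := Nat.div_add_mod m k
        rw [h2] at h3
        rw [← hg] at h4
        have h5 : (x : ℕ) < m := h1
        simp only [coe_range, Set.mem_Iio]
        omega
      · have h1 := (mem_filter.1 hx).2.2
        have h2 := (mem_filter.1 hy).2.2
        refine Fin.ext ?_
        rw [← Nat.div_add_mod x k, ← Nat.div_add_mod y k, h1, h2]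
        simp only at hxy
        rw [hxy]
    rw [card_range] at h1
    exact h1.trans_lt (Nat.mod_lt _ hk0)
  -- `c` is missing in the current block; it will go to the recolored vertex `u`.
  obtain ⟨c, hc, hcR⟩ := exists_mem_notMem_of_card_lt_card (s := R.image col) (t := range k)
    (by rw [card_range]; exact card_image_le.trans_lt hRk)
  rw [mem_range] at hc
  -- Every color is excluded by the current block or by a neighbor of `m`, so the block is nearly
  -- full already.
  have hcover : k ≤ #R + D := by
    have h1 : range k ⊆ R.image col ∪ N.image col := by
      intro d hd
      by_contra hd'
      rw [mem_union, not_or] at hd'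
      refine hno d (mem_range.1 hd) (valid_update hv fun x hx hxd => ⟨fun h => hd'.2 ?_, ?_⟩)
      · exact mem_image.2 ⟨x, by simp [hN, hx, h], hxd⟩
      · rw [hbl x hx.le, hbl m le_rfl]
        exact fun h => hd'.1 (mem_image.2 ⟨x, by simp [hR, hx, h.symm, hg], hxd⟩)
    have h2 := (card_le_card h1).trans (card_union_le _ _)
    rw [card_range] at h2
    have h3 : #(R.image col) ≤ #R := card_image_le
    have h4 : #(N.image col) ≤ #N := card_image_le
    omega
  set X := univ.filter fun x : Fin n => x < m ∧ col x = c with hX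
  have hXblock : ∀ x ∈ X, (x : ℕ) / k < g := by
    intro x hx
    obtain ⟨-, h1, h2⟩ := mem_filter.1 hx
    refine lt_of_le_of_ne (Nat.div_le_div_right (le_of_lt h1)) fun h => hcR ?_
    exact mem_image.2 ⟨x, by simp [hR, h1, h], h2⟩
  have hXg : #X ≤ g := by
    have h1 : #X ≤ #(range g) := by
      refine card_le_card_of_injOn (fun x => (x : ℕ) / k)
        (fun x hx => by simpa using hXblock x hx) fun x hx y hy hxy => ?_
      obtain ⟨-, hx1, hx2⟩ := mem_filter.1 hx
      obtain ⟨-, hy1, hy2⟩ := mem_filter.1 hy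
      by_contra hne
      refine (hv x y hx1 hy1 hne (hx2.trans hy2.symm)).2 ?_
      rw [hbl x (le_of_lt hx1), hbl y (le_of_lt hy1)]
      exact hxy
    rwa [card_range] at h1
  -- Two obstructions for `u` remain: being adjacent to a vertex of color `c` (the set `Y`), and
  -- having the color of a neighbor of `m` (the set `Z`).
  set Y := X.biUnion fun x => univ.filter fun y : Fin n => G.Adj x y with hY
  have hYc : #Y ≤ g * D := by
    refine (card_biUnion_le_card_mul _ _ D fun x _ => hD x _ fun u hu => ?_).trans
      (Nat.mul_le_mul_right D hXg)
    exact (mem_filter.1 hu).2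
  set Z := R.filter fun u => col u ∈ N.image col with hZ
  have hZc : #Z ≤ D := by
    refine le_trans ?_ ((card_image_le (s := N) (f := col)).trans hND)
    refine card_le_card_of_injOn col (fun u hu => (mem_filter.1 hu).2) fun x hx y hy hxy => ?_
    obtain ⟨-, hx1, hx2⟩ := mem_filter.1 (mem_filter.1 hx).1
    obtain ⟨-, hy1, hy2⟩ := mem_filter.1 (mem_filter.1 hy).1
    by_contra hne
    refine (hv x y hx1 hy1 hne hxy).2 ?_
    rw [hbl x (le_of_lt hx1), hbl y (le_of_lt hy1), hx2, hy2]
  -- #R ≥ k − D > T·D ≥ g·D + D ≥ #Y + #Z.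
  obtain ⟨u, huR, huYZ⟩ := exists_mem_notMem_of_card_lt_card (s := Y ∪ Z) (t := R) (by
    refine lt_of_le_of_lt (card_union_le _ _) ?_
    have h1 : g * D + D ≤ T * D := by
      rw [← Nat.succ_mul]; exact Nat.mul_le_mul_right D hgT
    have h2 : (T + 1) * D = T * D + D := Nat.succ_mul _ _
    omega)
  rw [mem_union, not_or] at huYZ
  obtain ⟨-, hum, hug⟩ := mem_filter.1 huR
  refine ⟨c, hc, u, hum, valid_swap hv hum (fun h => hcR (mem_image.2 ⟨u, huR, h⟩)) ?_ ?_ ?_⟩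
  · rw [hbl u hum.le, hbl m le_rfl, hug]
  · intro x hx hadj hcol
    exact huYZ.2 (mem_filter.2 ⟨huR, mem_image.2 ⟨x, by simp [hN, hx, hadj], hcol⟩⟩)
  · intro x hx hxc
    have hxX : x ∈ X := by simp [hX, hx, hxc]
    refine ⟨fun h => huYZ.1 (mem_biUnion.2 ⟨x, hxX, by simp [h.symm]⟩), ?_⟩
    rw [hbl u hum.le, hbl x hx.le, hug]
    exact (hXblock x hxX).ne'

theorem exists_step {m : Fin n} (w : Fin n → ℕ)
    (hD : ∀ v (s : Finset (Fin n)), (∀ u ∈ s, G.Adj v u) → #s ≤ D)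
    (hk : (T + 1) * D < k) (hv : Valid G k T col m) : ∃ col', Step G w k T m col col' := by
  by_cases h : ∃ c < k, Valid G k T (Function.update col m c) (m + 1)
  · obtain ⟨c, hc, hmin⟩ := exists_min_image
      ((range k).filter fun c => Valid G k T (Function.update col m c) (m + 1))
      (load w k col m) (by
        obtain ⟨c, hc, hval⟩ := h
        exact ⟨c, mem_filter.2 ⟨mem_range.2 hc, hval⟩⟩)
    obtain ⟨hc, hval⟩ := mem_filter.1 hc
    exact ⟨_, Or.inl ⟨c, mem_range.1 hc, hval, fun d hd hdval =>
      hmin d (mem_filter.2 ⟨mem_range.2 hd, hdval⟩), rfl⟩⟩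
  · push Not at h
    obtain ⟨c, hc, u, hu, hval⟩ := exists_swap hD hk hv h
    exact ⟨_, Or.inr ⟨h, c, hc, u, hu, hval, rfl⟩⟩

end BlockGreedy

/-! ### The invariant: balance of loads against total weights -/

namespace BlockGreedy

open Finset

open scoped Classical

variable {n : ℕ} {G : SimpleGraph (Fin n)} {w : Fin n → ℕ} {k T : ℕ} {col : Fin n → ℕ} {D : ℕ}

theorem sum_le_sum_of_injOn {ι κ : Type*} {s : Finset ι} {t : Finset κ} {a : ι → ℕ} {b : κ → ℕ}
    (f : ι → κ) (hf : Set.InjOn f s) (hst : ∀ i ∈ s, f i ∈ t) (hab : ∀ i ∈ s, a i ≤ b (f i)) :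
    ∑ i ∈ s, a i ≤ ∑ i ∈ t, b i := by
  refine (sum_le_sum hab).trans ?_
  rw [← sum_image (f := b) hf]
  exact sum_le_sum_of_subset (image_subset_iff.2 hst)

/-- A complete block contains every color. -/
theorem exists_mem_block {m g j : ℕ} (hv : Valid G k T col m)
    (hcol : ∀ a : Fin n, (a : ℕ) < m → col a < k) (hgT : g < T) (hm : (g + 1) * k ≤ m)
    (hmn : m ≤ n) (hj : j < k) : ∃ a : Fin n, (a : ℕ) < m ∧ col a = j ∧ (a : ℕ) / k = g := by
  have hk0 : 0 < k := by omega
  have hlt : ∀ r : Fin k, g * k + r < m := fun r => by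
    have := r.2
    rw [Nat.succ_mul] at hm
    omega
  have hdiv : ∀ r : Fin k, (g * k + r) / k = g := fun r => by
    rw [mul_comm, Nat.mul_add_div hk0, Nat.div_eq_of_lt r.2, add_zero]
  have hblock : ∀ r : Fin k, block k T (g * k + r) = g := fun r => by
    rw [block_of_lt, hdiv]
    exact (Nat.div_lt_iff_lt_mul hk0).1 (by rwa [hdiv])
  let p : Fin k → Fin n := fun r => ⟨g * k + r, (hlt r).trans_le hmn⟩
  let f : Fin k → Fin k := fun r => ⟨col (p r), hcol (p r) (hlt r)⟩
  have hf : Function.Injective f := by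
    intro r s hrs
    by_contra hne
    refine (hv (p r) (p s) (hlt r) (hlt s) (fun h => hne ?_) (Fin.mk.inj_iff.1 hrs)).2 ?_
    · have := Fin.mk.inj_iff.1 h
      exact Fin.ext (by omega)
    · exact (hblock r).trans (hblock s).symm
  obtain ⟨r, hr⟩ := Finite.injective_iff_surjective.1 hf ⟨j, hj⟩
  exact ⟨p r, hlt r, congrArg Fin.val hr, hdiv r⟩

/-- Each vertex of color `h` beyond the first block is sent to the vertex of color `j` in the
preceding, complete block, which is at least as heavy. The map is injective because `h` occurs at
most once per block. -/
theorem load_le_total_of_le {m h j : ℕ} (hw : Antitone w) (hv : Valid G k T col m)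
    (hcol : ∀ a : Fin n, (a : ℕ) < m → col a < k) (hm : m ≤ T * k) (hmn : m ≤ n) (hj : j < k) :
    load w k col m h ≤ total w col m j := by
  have hk0 : 0 < k := by omega
  have hex : ∀ a : Fin n, (a : ℕ) < m → k ≤ (a : ℕ) →
      ∃ b : Fin n, (b : ℕ) < m ∧ col b = j ∧ (b : ℕ) / k + 1 = a / k := by
    intro a ha hka
    have h1 : 1 ≤ (a : ℕ) / k := (Nat.one_le_div_iff hk0).2 hka
    have h2 : (a : ℕ) / k < T := (Nat.div_lt_iff_lt_mul hk0).2 (ha.trans_le hm)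
    obtain ⟨b, hb1, hb2, hb3⟩ := exists_mem_block (g := a / k - 1) hv hcol (by omega)
      (by rw [Nat.sub_add_cancel h1]; exact (Nat.div_mul_le_self _ _).trans ha.le) hmn hj
    exact ⟨b, hb1, hb2, by omega⟩
  choose! f hf1 hf2 hf3 using hex
  refine sum_le_sum_of_injOn f (fun a ha b hb hab => ?_) (fun a ha => ?_) fun a ha => ?_
  · obtain ⟨-, ha1, ha2, ha3⟩ := mem_filter.1 ha
    obtain ⟨-, hb1, hb2, hb3⟩ := mem_filter.1 hb
    by_contra hne
    refine (hv a b ha2 hb2 hne (ha1.trans hb1.symm)).2 ?_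
    rw [block_of_lt (ha2.trans_le hm), block_of_lt (hb2.trans_le hm), ← hf3 a ha2 ha3,
      ← hf3 b hb2 hb3, hab]
  · obtain ⟨-, -, ha2, ha3⟩ := mem_filter.1 ha
    simp [hf1 a ha2 ha3, hf2 a ha2 ha3]
  · obtain ⟨-, -, ha2, ha3⟩ := mem_filter.1 ha
    refine hw ?_
    by_contra hlt
    have h1 : (a : ℕ) / k ≤ f a / k := Nat.div_le_div_right (le_of_lt (not_le.1 hlt))
    have h2 := hf3 a ha2 ha3
    omega

theorem mul_le_total {m j : ℕ} {v : Fin n} (hw : Antitone w) (hv : Valid G k T col m)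
    (hcol : ∀ a : Fin n, (a : ℕ) < m → col a < k) (hm : T * k ≤ m) (hmv : m ≤ v) (hj : j < k) :
    T * w v ≤ total w col m j := by
  have : Nonempty (Fin n) := ⟨v⟩
  have hex : ∀ g, g < T → ∃ a : Fin n, (a : ℕ) < m ∧ col a = j ∧ (a : ℕ) / k = g := fun g hg =>
    exists_mem_block hv hcol hg ((Nat.mul_le_mul_right k hg).trans hm) (hmv.trans v.2.le) hj
  choose! f hf1 hf2 hf3 using hex
  have h : ∑ _g ∈ range T, w v ≤ total w col m j := by
    refine sum_le_sum_of_injOn f (fun a ha b hb hab => ?_) (fun a ha => ?_) fun a ha => ?_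
    · rw [← hf3 a (by simpa using ha), ← hf3 b (by simpa using hb), hab]
    · have := mem_range.1 ha
      simp [hf1 a this, hf2 a this]
    · exact hw (le_of_lt ((hf1 a (mem_range.1 ha)).trans_le hmv))
  simpa using h

theorem load_le_total (m c : ℕ) : load w k col m c ≤ total w col m c :=
  sum_le_sum_of_subset fun a ha => by
    simp only [mem_filter, mem_univ, true_and] at ha ⊢
    exact ⟨ha.1, ha.2.1⟩

/-- The vertex of color `j` in the first block is absent from the load and at least as heavy as `v`.
-/
theorem load_add_le_total {m j : ℕ} {v : Fin n} (hw : Antitone w) (hv : Valid G k T col m)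
    (hcol : ∀ a : Fin n, (a : ℕ) < m → col a < k) (hT : 0 < T) (hm : T * k ≤ m) (hmv : m ≤ v)
    (hj : j < k) : load w k col m j + w v ≤ total w col m j := by
  obtain ⟨a, ha1, ha2, ha3⟩ := exists_mem_block hv hcol hT
    (by rw [zero_add]; exact (Nat.mul_le_mul_right k hT).trans hm) (hmv.trans v.2.le) hj
  have hak : (a : ℕ) < k := (Nat.div_eq_zero_iff_lt (by omega)).1 ha3
  have h : load w k col m j + w a ≤ total w col m j := by
    rw [load, add_comm _ (w a), ← sum_insert (f := w) (a := a) (by simp; omega)]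
    refine sum_le_sum_of_subset fun b hb => ?_
    simp only [mem_insert, mem_filter, mem_univ, true_and] at hb ⊢
    rcases hb with rfl | hb
    · exact ⟨ha2, ha1⟩
    · exact ⟨hb.1, hb.2.1⟩
  exact (Nat.add_le_add_left (hw (le_of_lt (ha1.trans_le hmv))) _).trans h

/-- Each blocked vertex is charged to a neighbor of color `j` that is at least as heavy; a vertex
`u` is charged at most `D` times, each time at most `w u`. -/
theorem sum_blocked_le (hD : ∀ v (s : Finset (Fin n)), (∀ u ∈ s, G.Adj v u) → #s ≤ D)
    (A : Finset ℕ) (m j : ℕ) : ∑ h ∈ A, blocked G w col m h j ≤ D * total w col m j := by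
  set U := univ.filter fun u : Fin n => col u = j ∧ (u : ℕ) < m with hU
  set P := univ.filter fun a : Fin n => (a : ℕ) < m ∧ ∃ u, col u = j ∧ (u : ℕ) < m ∧
    G.Adj a u ∧ w a ≤ w u with hP
  have h1 : ∑ h ∈ A, blocked G w col m h j ≤ ∑ a ∈ P, w a := by
    have : ∀ h, blocked G w col m h j = ∑ a ∈ P with col a = h, w a := fun h => by
      rw [blocked, hP, filter_filter]
      refine sum_congr (filter_congr fun a _ => ?_) fun _ _ => rfl
      tauto
    simp_rw [this]
    rw [← sum_biUnion fun x _ y _ hxy => by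
      rw [Function.onFun, disjoint_left]
      intro a ha hb
      exact hxy ((mem_filter.1 ha).2.symm.trans (mem_filter.1 hb).2)]
    refine sum_le_sum_of_subset fun a ha => ?_
    obtain ⟨h, -, ha⟩ := mem_biUnion.1 ha
    exact (mem_filter.1 ha).1
  have h2 : ∑ a ∈ P, w a ≤ ∑ a ∈ P, ∑ u ∈ U, if G.Adj u a ∧ w a ≤ w u then w u else 0 := by
    refine sum_le_sum fun a ha => ?_
    obtain ⟨-, -, u, hu1, hu2, hu3, hu4⟩ := mem_filter.1 ha
    refine le_trans ?_ (single_le_sum (f := fun u => if G.Adj u a ∧ w a ≤ w u then w u else 0)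
      (fun _ _ => Nat.zero_le _) (show u ∈ U by simp [hU, hu1, hu2]))
    rwa [if_pos ⟨hu3.symm, hu4⟩]
  have h3 : ∑ a ∈ P, ∑ u ∈ U, (if G.Adj u a ∧ w a ≤ w u then w u else 0) ≤ ∑ u ∈ U, D * w u := by
    rw [sum_comm]
    refine sum_le_sum fun u _ => ?_
    rw [← sum_filter, sum_const, smul_eq_mul]
    exact Nat.mul_le_mul_right _ (hD u _ fun a ha => (mem_filter.1 ha).2.1)
  rw [total, mul_sum]
  exact h1.trans (h2.trans h3)

/-! ### Effect of coloring one more vertex -/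

section Update

variable {m : Fin n} {c j : ℕ}

theorem total_update_of_ne (hj : j ≠ c) :
    total w (Function.update col m c) (m + 1) j = total w col m j := by
  refine sum_congr (filter_congr fun a _ => ?_) fun _ _ => rfl
  rcases eq_or_ne a m with rfl | h
  · simp [hj.symm]
  · have : (a : ℕ) ≠ m := fun h' => h (Fin.ext h')
    rw [Function.update_of_ne h]
    simp only [and_congr_right_iff]
    omega

theorem load_update_of_ne (hj : j ≠ c) :
    load w k (Function.update col m c) (m + 1) j = load w k col m j := by
  refine sum_congr (filter_congr fun a _ => ?_) fun _ _ => rfl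
  rcases eq_or_ne a m with rfl | h
  · simp [hj.symm]
  · have : (a : ℕ) ≠ m := fun h' => h (Fin.ext h')
    rw [Function.update_of_ne h]
    simp only [and_congr_right_iff]
    omega

theorem le_total_update : total w col m j ≤ total w (Function.update col m c) (m + 1) j := by
  refine sum_le_sum_of_subset fun a ha => ?_
  simp only [mem_filter, mem_univ, true_and] at ha ⊢
  have : a ≠ m := fun h => by simp [h] at ha
  rw [Function.update_of_ne this]
  exact ⟨ha.1, by omega⟩

theorem load_update_self_le :
    load w k (Function.update col m c) (m + 1) c ≤ load w k col m c + w m := by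
  rw [load, load, add_comm _ (w m), ← sum_insert (f := w) (a := m) (by simp)]
  refine sum_le_sum_of_subset fun a ha => ?_
  simp only [mem_insert, mem_filter, mem_univ, true_and] at ha ⊢
  rcases eq_or_ne a m with rfl | h
  · exact Or.inl rfl
  · have : (a : ℕ) ≠ m := fun h' => h (Fin.ext h')
    rw [Function.update_of_ne h] at ha
    exact Or.inr ⟨ha.1, by omega, ha.2.2⟩

theorem le_blocked_update {h : ℕ} :
    blocked G w col m h j ≤ blocked G w (Function.update col m c) (m + 1) h j := by
  have hne : ∀ a : Fin n, (a : ℕ) < m → a ≠ m := fun a ha h => by simp [h] at ha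
  refine sum_le_sum_of_subset fun a ha => ?_
  simp only [mem_filter, mem_univ, true_and] at ha ⊢
  obtain ⟨ha1, ha2, u, hu1, hu2, hu3⟩ := ha
  refine ⟨by rwa [Function.update_of_ne (hne a ha2)], by omega, u, ?_, by omega, hu3⟩
  rwa [Function.update_of_ne (hne u hu2)]

theorem blocked_add_le_update {u : Fin n} (hu : u < m) (huj : col u = j) (hadj : G.Adj m u)
    (hw : w m ≤ w u) :
    blocked G w col m c j + w m ≤ blocked G w (Function.update col m c) (m + 1) c j := by
  have hne : ∀ a : Fin n, (a : ℕ) < m → a ≠ m := fun a ha h => by simp [h] at ha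
  rw [blocked, blocked, add_comm _ (w m), ← sum_insert (f := w) (a := m) (by simp)]
  refine sum_le_sum_of_subset fun a ha => ?_
  simp only [mem_insert, mem_filter, mem_univ, true_and] at ha ⊢
  rcases ha with rfl | ⟨ha1, ha2, v, hv1, hv2, hv3⟩
  · refine ⟨by simp, by omega, u, ?_, Nat.lt_succ_of_lt hu, hadj, hw⟩
    rwa [Function.update_of_ne hu.ne]
  · refine ⟨by rwa [Function.update_of_ne (hne a ha2)], by omega, v, ?_, by omega, hv3⟩
    rwa [Function.update_of_ne (hne v hv2)]

end Update

variable (G w k T D) in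
/-- The invariant of the algorithm when `m` vertices have been colored. -/
structure Inv (col : Fin n → ℕ) (m : ℕ) : Prop where
  valid : Valid G k T col m
  lt : ∀ a : Fin n, (a : ℕ) < m → col a < k
  load_le : T * k ≤ m → ∀ h < k, ∀ j < k,
    load w k col m h ≤ total w col m j + blocked G w col m h j
  balanced : ∀ h < k, ∀ j < k,
    (k - D) * T * load w k col m h ≤ (k * T + (k - D)) * total w col m j

/-- `Inv.balanced` is load ≤ (k/(k−D) + 1/T)·total with denominators cleared, and this factor is at
least 1. -/
theorem balanced_of_le {a b : ℕ} (h : a ≤ b) :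
    (k - D) * T * a ≤ (k * T + (k - D)) * b :=
  Nat.mul_le_mul ((Nat.mul_le_mul_right T (Nat.sub_le k D)).trans (Nat.le_add_right _ _)) h

/-- Up to the end of the blocks the invariant follows from validity and the range of the colors, so
the effect of a swap on the loads need not be followed. -/
theorem Inv.of_le {m : ℕ} (hw : Antitone w) (hv : Valid G k T col m)
    (hcol : ∀ a : Fin n, (a : ℕ) < m → col a < k) (hm : m ≤ T * k) (hmn : m ≤ n) :
    Inv G w k T D col m where
  valid := hv
  lt := hcol
  load_le := fun _ _ _ _ hj =>
    (load_le_total_of_le hw hv hcol hm hmn hj).trans (Nat.le_add_right _ _)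
  balanced := fun _ _ _ hj => balanced_of_le (load_le_total_of_le hw hv hcol hm hmn hj)

theorem Inv.zero (hw : Antitone w) : Inv G w k T D col 0 :=
  .of_le hw (fun _ _ ha => absurd ha (Nat.not_lt_zero _)) (fun _ ha => absurd ha (Nat.not_lt_zero _))
    (Nat.zero_le _) (Nat.zero_le _)

/-- The least load is at most the average of the bounds total(j) + blocked(d,j) over k−D colors d
free at `m`, and all blocked weights together are at most D·total(j). -/
theorem mul_load_le {m : Fin n} {c j : ℕ}
    (hD : ∀ v (s : Finset (Fin n)), (∀ u ∈ s, G.Adj v u) → #s ≤ D)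
    (hload : ∀ h < k, load w k col m h ≤ total w col m j + blocked G w col m h j)
    (hmin : ∀ d < k, (∀ x < m, col x = d → ¬ G.Adj m x) → load w k col m c ≤ load w k col m d) :
    (k - D) * load w k col m c ≤ k * total w col m j := by
  set N := univ.filter fun x : Fin n => x < m ∧ G.Adj m x with hN
  have hND : #N ≤ D := hD m N fun u hu => (mem_filter.1 hu).2.2
  rcases Nat.lt_or_ge k D with hkD | hkD
  · simp [Nat.sub_eq_zero_of_le hkD.le]
  set A := range k \ N.image col with hA
  have hAcard : k - D ≤ #A := by
    have h1 : _ ≤ #A := le_card_sdiff (N.image col) (range k)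
    have h2 : #(N.image col) ≤ #N := card_image_le
    rw [card_range] at h1
    omega
  have hAle : ∀ d ∈ A, load w k col m c ≤ total w col m j + blocked G w col m d j := by
    intro d hd
    obtain ⟨hd1, hd2⟩ := mem_sdiff.1 hd
    refine (hmin d (mem_range.1 hd1) fun x hx hxd hadj => hd2 ?_).trans (hload d (mem_range.1 hd1))
    exact mem_image.2 ⟨x, by simp [hN, hx, hadj], hxd⟩
  obtain ⟨A', hA'sub, hA'card⟩ := exists_subset_card_eq hAcard
  have h1 := sum_le_sum fun d (hd : d ∈ A') => hAle d (hA'sub hd)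
  rw [sum_add_distrib, sum_const, sum_const, hA'card, smul_eq_mul, smul_eq_mul] at h1
  have h2 := sum_blocked_le (w := w) (col := col) hD A' m j
  have h3 : k * total w col m j = (k - D) * total w col m j + D * total w col m j := by
    rw [← add_mul, Nat.sub_add_cancel hkD]
  omega

theorem Inv.step_greedy {m : Fin n} {c : ℕ} (hw : Antitone w)
    (hD : ∀ v (s : Finset (Fin n)), (∀ u ∈ s, G.Adj v u) → #s ≤ D) (hT : 0 < T)
    (hm : T * k ≤ m) (hinv : Inv G w k T D col m) (hc : c < k)
    (hval : Valid G k T (Function.update col m c) (m + 1))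
    (hmin : ∀ d < k, Valid G k T (Function.update col m d) (m + 1) →
      load w k col m c ≤ load w k col m d) :
    Inv G w k T D (Function.update col m c) (m + 1) := by
  have hmin' : ∀ d < k, (∀ x < m, col x = d → ¬ G.Adj m x) →
      load w k col m c ≤ load w k col m d := fun d hd hd' =>
    hmin d hd (valid_update hinv.valid fun x hx hxd =>
      ⟨hd' x hx hxd, (block_ne_of_lt_of_le hx hm).symm⟩)
  have hload := hinv.load_le hm
  have hadd : ∀ j < k, load w k col m j + w m ≤ total w col m j := fun j hj =>
    load_add_le_total hw hinv.valid hinv.lt hT hm le_rfl hj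
  refine ⟨hval, fun a ha => ?_, fun _ h hh j hj => ?_, fun h hh j hj => ?_⟩
  · rcases eq_or_ne a m with rfl | h
    · simpa using hc
    · rw [Function.update_of_ne h]
      exact hinv.lt a (Fin.lt_def.1 (lt_of_le_of_ne (Fin.le_def.2 (Nat.lt_succ_iff.1 ha)) h))
  · by_cases hhc : h = c
    · subst hhc
      by_cases hjc : j = h
      · subst hjc
        exact (load_le_total _ _).trans (Nat.le_add_right _ _)
      rw [total_update_of_ne hjc]
      have h1 := load_update_self_le (w := w) (k := k) (col := col) (m := m) (c := h)
      -- If `j` was free, minimality and the first-block vertex of color `j` absorb `w m`; otherwise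
      -- `w m` is added to the blocked weight.
      by_cases hbl : ∀ x < m, col x = j → ¬ G.Adj m x
      · have h2 := hmin' j hj hbl
        have h3 := hadd j hj
        omega
      · push Not at hbl
        obtain ⟨x, hx, hxj, hadj⟩ := hbl
        have h2 := blocked_add_le_update (c := h) hx hxj hadj (hw hx.le)
        have h3 := hload h hh j hj
        omega
    · rw [load_update_of_ne hhc]
      exact (hload h hh j hj).trans (Nat.add_le_add le_total_update le_blocked_update)
  · by_cases hhc : h = c
    · subst hhc
      by_cases hjc : j = h
      · subst hjc
        exact balanced_of_le (load_le_total _ _)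
      rw [total_update_of_ne hjc]
      refine (Nat.mul_le_mul_left _ load_update_self_le).trans ?_
      -- The old load contributes the term k/(k−D), the new vertex the term 1/T.
      have h1 := Nat.mul_le_mul_left T
        (mul_load_le (c := h) hD (fun d hd => hload d hd j hj) hmin')
      have h2 := Nat.mul_le_mul_left (k - D)
        (mul_le_total hw hinv.valid hinv.lt hm le_rfl hj)
      calc (k - D) * T * (load w k col m h + w m)
          = T * ((k - D) * load w k col m h) + (k - D) * (T * w m) := by ring
        _ ≤ T * (k * total w col m j) + (k - D) * total w col m j := Nat.add_le_add h1 h2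
        _ = (k * T + (k - D)) * total w col m j := by ring
    · rw [load_update_of_ne hhc]
      exact (hinv.balanced h hh j hj).trans (Nat.mul_le_mul_left _ le_total_update)

theorem Inv.step {m : Fin n} {col' : Fin n → ℕ} (hw : Antitone w)
    (hD : ∀ v (s : Finset (Fin n)), (∀ u ∈ s, G.Adj v u) → #s ≤ D) (hT : 0 < T)
    (hk : (T + 1) * D < k) (hinv : Inv G w k T D col m) (hstep : Step G w k T m col col') :
    Inv G w k T D col' (m + 1) := by
  have hDk : D < k := lt_of_le_of_lt (Nat.le_mul_of_pos_left D (by omega)) hk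
  have hlt : ∀ c < k, ∀ a : Fin n, (a : ℕ) < m + 1 → Function.update col m c a < k := by
    intro c hc a ha
    rcases eq_or_ne a m with rfl | h
    · simpa using hc
    · rw [Function.update_of_ne h]
      exact hinv.lt a (Fin.lt_def.1 (lt_of_le_of_ne (Fin.le_def.2 (Nat.lt_succ_iff.1 ha)) h))
  rcases Nat.lt_or_ge m (T * k) with hm | hm
  · rcases hstep with ⟨c, hc, hval, -, rfl⟩ | ⟨-, c, hc, u, hu, hval, rfl⟩
    · exact .of_le hw hval (hlt c hc) hm m.2
    · refine .of_le hw hval (fun a ha => ?_) hm m.2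
      rcases eq_or_ne a u with rfl | h
      · simpa [swap] using hc
      · rw [swap, Function.update_of_ne h]
        exact hlt _ (hinv.lt u hu) a ha
  · rcases hstep with ⟨c, hc, hval, hmin, rfl⟩ | ⟨hno, -⟩
    · exact hinv.step_greedy hw hD hT hm hc hval hmin
    -- After the blocks no swap can occur: `D < k` leaves a color that no neighbor has.
    · exfalso
      set N := univ.filter fun x : Fin n => x < m ∧ G.Adj m x with hN
      have hND : #N ≤ D := hD m N fun u hu => (mem_filter.1 hu).2.2
      obtain ⟨c, hc, hcN⟩ := exists_mem_notMem_of_card_lt_card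
        (s := N.image col) (t := range k) (by
          rw [card_range]; exact card_image_le.trans_lt (hND.trans_lt hDk))
      refine hno c (mem_range.1 hc) (valid_update hinv.valid fun x hx hxc => ⟨fun h => hcN ?_, ?_⟩)
      · exact mem_image.2 ⟨x, by simp [hN, hx, h], hxc⟩
      · exact (block_ne_of_lt_of_le hx hm).symm

theorem exists_inv (hw : Antitone w)
    (hD : ∀ v (s : Finset (Fin n)), (∀ u ∈ s, G.Adj v u) → #s ≤ D) (hT : 0 < T)
    (hk : (T + 1) * D < k) (m : ℕ) (hm : m ≤ n) : ∃ col, Inv G w k T D col m := by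
  induction m with
  | zero => exact ⟨fun _ => 0, .zero hw⟩
  | succ m ih =>
    obtain ⟨col, hcol⟩ := ih (by omega)
    obtain ⟨col', hcol'⟩ := exists_step (m := ⟨m, hm⟩) w hD hk hcol.valid
    exact ⟨col', hcol.step hw hD hT hk hcol'⟩

end BlockGreedy

/-! ### From the invariant to EQ1, and the numerical estimates -/

namespace BlockGreedy

open Finset

/-- The weights, multiplied by the product of their denominators. -/
def natWeight {V : Type*} [Fintype V] (w : V → ℚ) (v : V) : ℕ :=
  (w v).num.toNat * (∏ u, (w u).den) / (w v).den

/-- The division in `natWeight` is exact, since each denominator divides the product. All weights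
are scaled by one positive factor, which cancels in the EQ1 inequalities. -/
theorem natWeight_cast {V : Type*} [Fintype V] {w : V → ℚ} (hw : ∀ v, 0 ≤ w v) (v : V) :
    (natWeight w v : ℚ) = (∏ u, (w u).den : ℕ) * w v := by
  obtain ⟨m, hm⟩ : (w v).den ∣ ∏ u, (w u).den := dvd_prod_of_mem _ (mem_univ v)
  have hden : (w v).den ≠ 0 := (w v).den_nz
  rw [natWeight, hm, mul_left_comm, Nat.mul_div_cancel_left _ (Nat.pos_of_ne_zero hden)]
  have hnum : (((w v).num.toNat : ℕ) : ℚ) = (w v).den * w v := by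
    rw [mul_comm, Rat.mul_den_eq_num]
    exact_mod_cast Int.toNat_of_nonneg (Rat.num_nonneg.2 (hw v))
  push_cast
  rw [hnum]
  ring

theorem exists_isEQ1_of_inv {V : Type*} [Fintype V] [DecidableEq V] {G : SimpleGraph V}
    {w : V → ℚ} {n k T D N : ℕ} (hN : 0 < N) (hD : D < k) (hT : 0 < T) (σ : Fin n ≃ V)
    {wt : Fin n → ℕ} (hwt : ∀ p, (wt p : ℚ) = N * w (σ p)) {col : Fin n → ℕ}
    (hinv : Inv (G.comap σ) wt k T D col n) {α : ℝ}
    (hα : (k * T + (k - D) : ℝ) ≤ α * ((k - D) * T)) :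
    ∃ c : G.Coloring (Fin k), WeightedColoring.IsEQ1 w α c ∧ ∀ p, (c (σ p) : ℕ) = col p := by
  let c : G.Coloring (Fin k) := SimpleGraph.Coloring.mk
    (fun v => ⟨col (σ.symm v), hinv.lt _ (σ.symm v).2⟩) fun {u v} huv h => by
      refine (hinv.valid (σ.symm u) (σ.symm v) (σ.symm u).2 (σ.symm v).2
        (fun h' => huv.ne (σ.symm.injective h')) (Fin.mk.inj_iff.1 h)).1 ?_
      simpa using huv
  have hc : ∀ p, (c (σ p) : ℕ) = col p := fun p => by
    change col (σ.symm (σ p)) = col p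
    rw [σ.symm_apply_apply]
  refine ⟨c, fun i j hi => ?_, hc⟩
  have hsum : ∀ S : Finset (Fin n), (N : ℚ) * WeightedColoring.weight w (S.map σ.toEmbedding) =
      (∑ p ∈ S, wt p : ℕ) := fun S => by
    rw [WeightedColoring.weight, sum_map, mul_sum]
    push_cast
    exact sum_congr rfl fun p _ => (hwt p).symm
  have hclass : ∀ i : Fin k, WeightedColoring.colorClass c i =
      (univ.filter fun a : Fin n => col a = i ∧ (a : ℕ) < n).map σ.toEmbedding := fun i => by
    ext v
    obtain ⟨p, rfl⟩ := σ.surjective v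
    simp [WeightedColoring.colorClass, Fin.ext_iff, hc]
  have herase : ∃ v ∈ WeightedColoring.colorClass c i,
      (N : ℚ) * WeightedColoring.weight w ((WeightedColoring.colorClass c i).erase v) ≤
        load wt k col n i := by
    have key : ∀ p : Fin n, col p = i → (∀ a : Fin n, a ≠ p → col a = i → k ≤ (a : ℕ)) →
        ∃ v ∈ WeightedColoring.colorClass c i,
          (N : ℚ) * WeightedColoring.weight w ((WeightedColoring.colorClass c i).erase v) ≤
            load wt k col n i := by
      intro p hp hle
      refine ⟨σ p, by simp [hclass, hp], ?_⟩
      rw [hclass, ← Equiv.coe_toEmbedding, ← map_erase, hsum, load]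
      refine Nat.cast_le.2 (sum_le_sum_of_subset fun a ha => ?_)
      simp only [mem_erase, mem_filter, mem_univ, true_and] at ha ⊢
      exact ⟨ha.2.1, ha.2.2, hle a ha.1 ha.2.1⟩
    -- The class has at most one vertex in the first block. That one is deleted; if there is none,
    -- the load is the whole weight of the class and any vertex may be deleted.
    by_cases h : ∃ p : Fin n, (p : ℕ) < k ∧ col p = i
    · obtain ⟨p, hpk, hp⟩ := h
      refine key p hp fun a hap ha => ?_
      by_contra hak
      have hkT : k ≤ T * k := Nat.le_mul_of_pos_left k hT
      refine (hinv.valid a p a.2 p.2 hap (ha.trans hp.symm)).2 ?_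
      rw [block_of_lt (by omega), block_of_lt (by omega), Nat.div_eq_of_lt hpk,
        Nat.div_eq_of_lt (not_le.1 hak)]
    · push Not at h
      obtain ⟨v, hv⟩ := hi
      rw [hclass] at hv
      obtain ⟨p, hp, rfl⟩ := mem_map.1 hv
      refine key p (mem_filter.1 hp).2.1 fun a _ ha => ?_
      by_contra hak
      exact h a (not_le.1 hak) ha
  obtain ⟨v, hv, hle⟩ := herase
  refine ⟨v, hv, ?_⟩
  set x := WeightedColoring.weight w ((WeightedColoring.colorClass c i).erase v)
  have hj : (N : ℚ) * WeightedColoring.weight w (WeightedColoring.colorClass c j) =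
      total wt col n j := by rw [hclass, hsum, total]
  set y := WeightedColoring.weight w (WeightedColoring.colorClass c j)
  have hbal := hinv.balanced i i.2 j j.2
  have hle' : (N : ℝ) * (x : ℝ) ≤ load wt k col n i := by exact_mod_cast hle
  have hj' : (N : ℝ) * (y : ℝ) = total wt col n j := by exact_mod_cast hj
  have hbal' : ((k - D) * T : ℝ) * load wt k col n i ≤
      (k * T + (k - D)) * total wt col n j := by
    have : (((k - D) * T * load wt k col n i : ℕ) : ℝ) ≤
      (((k * T + (k - D)) * total wt col n j : ℕ) : ℝ) := Nat.cast_le.2 hbal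
    push_cast [Nat.cast_sub hD.le] at this
    exact this
  have hkD : (0 : ℝ) < k - D := sub_pos.2 (Nat.cast_lt.2 hD)
  have hT' : (0 : ℝ) < T := Nat.cast_pos.2 hT
  have hN' : (0 : ℝ) < N := Nat.cast_pos.2 hN
  have hpos : (0 : ℝ) < (k - D) * T * N := by positivity
  refine le_of_mul_le_mul_left ?_ hpos
  calc ((k - D) * T * N : ℝ) * x = (k - D) * T * (N * x) := by ring
    _ ≤ (k - D) * T * load wt k col n i := by gcongr
    _ ≤ (k * T + (k - D)) * total wt col n j := hbal'
    _ ≤ α * ((k - D) * T) * total wt col n j := by gcongr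
    _ = (k - D) * T * N * (α * y) := by rw [← hj']; ring

/-- Since (1+ε)² ≥ 1 and the logarithm is nonnegative, the coefficient of `D` is at least 4·4/ε².
The rest of the proof uses the lower bound on `k` in this form. -/
theorem color_bound {ε : ℝ} {k D : ℕ} (hε : 0 < ε) (hε1 : ε ≤ 1 / 10)
    (h : 4 * (1 + ε) ^ 2 / ε ^ 2 * (Real.log (1 / ε) + 4) * (D : ℝ) ≤ k) :
    16 * (D : ℝ) ≤ ε ^ 2 * k := by
  have hlog : 0 ≤ Real.log (1 / ε) := Real.log_nonneg (by rw [le_div_iff₀ hε]; linarith)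
  have h1 : 16 / ε ^ 2 * D ≤ k := by
    refine le_trans ?_ h
    have h2 : 4 / ε ^ 2 ≤ 4 * (1 + ε) ^ 2 / ε ^ 2 := by
      gcongr
      nlinarith
    have h3 : 16 / ε ^ 2 = 4 / ε ^ 2 * 4 := by ring
    rw [h3]
    gcongr
    linarith
  rw [div_mul_eq_mul_div, div_le_iff₀ (by positivity)] at h1
  linarith

/-- From ε(T+1) ≤ 2 one gets 16(T+1)D ≤ 2εk ≤ k/5. -/
theorem mul_lt_of_color_bound {ε : ℝ} {k D T : ℕ} (hε : 0 < ε) (hε1 : ε ≤ 1 / 10) (hk : 1 ≤ k)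
    (h : 16 * (D : ℝ) ≤ ε ^ 2 * k) (hT : (T : ℝ) ≤ 1 / ε + 1) : (T + 1) * D < k := by
  have hk' : (1 : ℝ) ≤ k := by exact_mod_cast hk
  have hεT : ε * T ≤ 1 + ε := by
    have := mul_le_mul_of_nonneg_left hT hε.le
    rw [mul_add, mul_one_div_cancel hε.ne'] at this
    linarith
  have h1 : ε * (T + 1) ≤ 2 := by nlinarith
  have h2 : (T + 1 : ℝ) * D < k := by
    have h3 : ε * (16 * ((T + 1) * D)) ≤ ε * (ε * (2 * k)) := by
      calc ε * (16 * ((T + 1) * D)) = (ε * (T + 1)) * (16 * D) := by ring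
        _ ≤ 2 * (ε ^ 2 * k) := by gcongr
        _ = ε * (ε * (2 * k)) := by ring
    have h4 := le_of_mul_le_mul_left h3 hε
    have h5 : ε * (2 * k) ≤ 1 / 10 * (2 * k) := by gcongr
    linarith
  exact_mod_cast h2

/-- The excess 3ε splits as 2ε + ε: D ≤ 2ε(k−D) bounds the contribution of k/(k−D), and 1 ≤ εT that
of 1/T. -/
theorem ratio_le {ε : ℝ} {k D T : ℕ} (hε : 0 < ε) (hε1 : ε ≤ 1 / 10)
    (h : 16 * (D : ℝ) ≤ ε ^ 2 * k) (hT : 1 / ε ≤ T) :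
    (k * T + (k - D) : ℝ) ≤ (1 + 3 * ε) * ((k - D) * T) := by
  have hεT : 1 ≤ ε * T := by
    rw [div_le_iff₀ hε] at hT
    linarith
  have hk' : (0 : ℝ) ≤ k := Nat.cast_nonneg k
  have hT' : (0 : ℝ) ≤ T := Nat.cast_nonneg T
  have h1 : 16 * (D : ℝ) ≤ ε * k := h.trans (by nlinarith)
  have hDk : 160 * (D : ℝ) ≤ k := by nlinarith
  have h2 : (D : ℝ) ≤ 2 * ε * (k - D) := by nlinarith
  have h3 : (D : ℝ) * T ≤ 2 * ε * (k - D) * T := by gcongr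
  have h4 : (k - D : ℝ) * 1 ≤ (k - D) * (ε * T) :=
    mul_le_mul_of_nonneg_left hεT (by linarith [(Nat.cast_nonneg D : (0 : ℝ) ≤ D)])
  nlinarith

theorem card_le_of_adj {V : Type*} [Fintype V] {G : SimpleGraph V} [DecidableRel G.Adj] {n : ℕ}
    (σ : Fin n ≃ V) (v : Fin n) (s : Finset (Fin n)) (hs : ∀ u ∈ s, (G.comap σ).Adj v u) :
    #s ≤ G.maxDegree := by
  rw [← card_map σ.toEmbedding]
  refine le_trans (card_le_card fun x hx => ?_) (G.degree_le_maxDegree (σ v))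
  obtain ⟨u, hu, rfl⟩ := mem_map.1 hx
  exact (G.mem_neighborFinset _ _).2 (hs u hu)

theorem exists_isEQ1 {V : Type*} [Fintype V] [DecidableEq V] (G : SimpleGraph V)
    [DecidableRel G.Adj] (w : V → ℚ) (ε : ℝ) (k : ℕ) (hw : ∀ v, 0 ≤ w v) (hε : 0 < ε)
    (hε1 : ε ≤ 1 / 10) (hk : 1 ≤ k)
    (h : 4 * (1 + ε) ^ 2 / ε ^ 2 * (Real.log (1 / ε) + 4) * (G.maxDegree : ℝ) ≤ (k : ℝ)) :
    ∃ c : G.Coloring (Fin k), WeightedColoring.IsEQ1 w (1 + 3 * ε) c := by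
  have hb := color_bound hε hε1 h
  have hT := mul_lt_of_color_bound (T := ⌈1 / ε⌉₊) hε hε1 hk hb
    (Nat.ceil_lt_add_one (by positivity)).le
  have hT0 : 0 < ⌈1 / ε⌉₊ := Nat.ceil_pos.2 (by positivity)
  let e := (Fintype.equivFin V).symm
  -- `Tuple.sort` sorts increasingly; the dual order makes the weights decrease.
  let σ := (Tuple.sort (OrderDual.toDual ∘ natWeight w ∘ e)).trans e
  have hanti : Antitone (natWeight w ∘ σ) := fun a b hab =>
    Tuple.monotone_sort (OrderDual.toDual ∘ natWeight w ∘ e) hab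
  obtain ⟨col, hcol⟩ := exists_inv hanti (card_le_of_adj (G := G) σ) hT0 hT _ le_rfl
  obtain ⟨c, hc, -⟩ := exists_isEQ1_of_inv
    (prod_pos fun u _ => (w u).den_pos : 0 < ∏ u, (w u).den)
    (lt_of_le_of_lt (Nat.le_mul_of_pos_left _ (by omega)) hT) hT0 σ
    (fun p => natWeight_cast hw (σ p)) hcol (ratio_le hε hε1 hb (Nat.le_ceil _))
  exact ⟨c, hc⟩

theorem isEQ1_of_injective {V : Type*} [Fintype V] [DecidableEq V] {G : SimpleGraph V} {k : ℕ}
    {w : V → ℚ} {α : ℝ} (hw : ∀ v, 0 ≤ w v) (hα : 0 ≤ α) (c : G.Coloring (Fin k))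
    (hc : Function.Injective c) : WeightedColoring.IsEQ1 w α c := by
  rintro i j ⟨v, hv⟩
  refine ⟨v, hv, ?_⟩
  have h : (WeightedColoring.colorClass c i).erase v = ∅ := by
    rw [erase_eq_empty_iff]
    refine Or.inr (eq_singleton_iff_unique_mem.2 ⟨hv, fun u hu => hc ?_⟩)
    exact (mem_filter.1 hu).2.trans (mem_filter.1 hv).2.symm
  rw [h, WeightedColoring.weight, sum_empty, Rat.cast_zero]
  exact mul_nonneg hα (Rat.cast_nonneg.2 (sum_nonneg fun u _ => hw u))

end BlockGreedy

/-! ## The program -/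

namespace BlockGreedy

open CostModel

/-- A vertex: its number, its weight and its row of the adjacency matrix. -/
abbrev Vertex := ℕ × ℕ × List ℕ

/-- A color, a position and the vertex at this position. -/
abbrev Cell := ℕ × ℕ × Vertex

/-- The number of colors, the number of blocks and the list of colors. -/
abbrev Param := ℕ × ℕ × List ℕ

/-- Adjacency of the vertices of two cells. -/
def adjacent (x y : Cell) : Bool := decide (1 ≤ x.2.2.2.2.getD y.2.2.1 0)

/-- The condition of `Valid` for two cells. -/
def compatible (P : Param) (m : ℕ) (x y : Cell) : Bool :=
  !(decide (x.2.1 ≤ m) && decide (y.2.1 ≤ m) && !decide (x.2.1 = y.2.1) && decide (x.1 = y.1)) ||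
    (!adjacent x y && !decide (block P.1 P.2.1 x.2.1 = block P.1 P.2.1 y.2.1))

/-- The test for `Valid`. -/
def validCells (P : Param) (m : ℕ) (s : List Cell) : Bool :=
  s.all fun x => s.all fun y => compatible P m x y

/-- Position `p` gets color `c`. -/
def setColor (s : List Cell) (p c : ℕ) : List Cell :=
  s.map fun x => if x.2.1 = p then (c, x.2) else x

/-- The computation of `load`. -/
def cellLoad (k : ℕ) (s : List Cell) (m c : ℕ) : ℕ :=
  ((s.filter fun x => decide (x.1 = c) && decide (x.2.1 < m) && decide (k ≤ x.2.1)).map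
    fun x => x.2.2.2.1).sum

/-- The valid colors for position `m`. -/
def validColors (P : Param) (m : ℕ) (s : List Cell) : List ℕ :=
  P.2.2.filter fun c => validCells P m (setColor s m c)

/-- The valid colors of least load for position `m`. -/
def bestColors (P : Param) (m : ℕ) (s : List Cell) : List ℕ :=
  (validColors P m s).filter fun c => (validColors P m s).all fun d =>
    decide (cellLoad P.1 s m c ≤ cellLoad P.1 s m d)

/-- The colorings in which position `m` swaps colors with an earlier one. -/
def swaps (P : Param) (m : ℕ) (s : List Cell) : List (List Cell) :=
  P.2.2.flatMap fun c => (s.filter fun u => decide (u.2.1 < m)).map fun u =>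
    setColor (setColor s m u.1) u.2.1 c

/-- The computation of a `Step`. -/
def stepCells (P : Param) (m : ℕ) (s : List Cell) : List Cell :=
  ((bestColors P m s).map (setColor s m) ++ (swaps P m s).filter (validCells P m)).headD s

/-- All steps in turn. -/
def runCells (P : Param) (l : List ℕ) (s : List Cell) : List Cell :=
  l.foldl (fun s m => stepCells P m s) s

/-- Insertion into a list of decreasing weights. -/
def insertDesc (a : Vertex) (l : List Vertex) : List Vertex :=
  (l.filter fun b => decide (a.2.1 ≤ b.2.1)) ++ a :: l.filter fun b => !decide (a.2.1 ≤ b.2.1)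

/-- Insertion sort by decreasing weights. -/
def sortDesc (l : List Vertex) : List Vertex := l.foldr insertDesc []

/-- The input of the program. -/
abbrev Input := ℕ × List (List ℕ) × List (ℕ × ℕ) × ℕ × (ℕ × ℕ) × Unit

/-- The computation of `natWeight`. -/
def scaledWeights (W : List (ℕ × ℕ)) : List ℕ :=
  W.map fun q => q.1 * (W.map Prod.snd).prod / q.2

/-- The list of the vertices of the input. -/
def vertexList (x : Input) : List Vertex :=
  (List.range x.2.1.length).map fun v => (v, (scaledWeights x.2.2.1).getD v 0, x.2.1.getD v [])

/-- The parameters of the input. -/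
def param (x : Input) : Param :=
  (x.2.2.2.1, x.2.2.2.2.1.2 / x.2.2.2.2.1.1 + 1,
    (List.range x.2.1.length).filter fun c => decide (c < x.2.2.2.1))

/-- The initial state. -/
def initCells (x : Input) : List Cell :=
  (List.range x.2.1.length).map fun p => (0, p, (sortDesc (vertexList x)).getD p (0, 0, []))

/-- The final state. -/
def finalCells (x : Input) : List Cell :=
  runCells (param x) (List.range x.2.1.length) (initCells x)

/-- The color of vertex `v` in a final state. -/
def colorOf (s : List Cell) (v : ℕ) : ℕ :=
  ((s.filter fun c => decide (c.2.2.1 = v)).map Prod.fst).headD 0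

/-- The output of the program. -/
def output (x : Input) : List ℕ :=
  if x.2.1.length ≤ x.2.2.2.1 then List.range x.2.1.length
  else (List.range x.2.1.length).map (colorOf (finalCells x))

/-! ### Running time -/

section PolyTime

open PolyTime

variable {α : Type} [Enc α]

theorem polyTime_ite_prop {β : Type} [Enc β] {c : α → Prop} [DecidablePred c] {f g : α → β}
    (hc : PolyTime fun x => decide (c x)) (hf : PolyTime f) (hg : PolyTime g) :
    PolyTime fun x => if c x then f x else g x := by
  convert hc.ite hf hg using 3 with x
  simp

theorem polyTime_adjacent {x y : α → Cell} (hx : PolyTime x) (hy : PolyTime y) :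
    PolyTime fun a => adjacent (x a) (y a) :=
  (const_nat 1).le (hx.snd.snd.snd.snd.getD hy.snd.snd.fst (const_nat 0))

theorem polyTime_block {k T p : α → ℕ} (hk : PolyTime k) (hT : PolyTime T) (hp : PolyTime p) :
    PolyTime fun a => block (k a) (T a) (p a) :=
  polyTime_ite_prop (hp.lt (hT.mul hk)) (hp.div hk) hp

variable {P : α → Param} {m c p : α → ℕ} {s : α → List Cell}

theorem polyTime_compatible {x y : α → Cell} (hP : PolyTime P) (hm : PolyTime m)
    (hx : PolyTime x) (hy : PolyTime y) :
    PolyTime fun a => compatible (P a) (m a) (x a) (y a) :=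
  ((((hx.snd.fst.le hm).and (hy.snd.fst.le hm)).and (hx.snd.fst.eq hy.snd.fst).not).and
    (hx.fst.eq hy.fst)).not.or ((polyTime_adjacent hx hy).not.and
      ((polyTime_block hP.fst hP.snd.fst hx.snd.fst).eq
        (polyTime_block hP.fst hP.snd.fst hy.snd.fst)).not)

theorem polyTime_validCells (hP : PolyTime P) (hm : PolyTime m) (hs : PolyTime s) :
    PolyTime fun a => validCells (P a) (m a) (s a) :=
  hs.all (f := fun a x => (s a).all fun y => compatible (P a) (m a) x y)
    ((hs.comp fst_apply).all (f := fun (q : α × Cell) y => compatible (P q.1) (m q.1) q.2 y)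
      (polyTime_compatible (hP.comp id.fst.fst) (hm.comp id.fst.fst) id.fst.snd id.snd))

theorem polyTime_setColor (hs : PolyTime s) (hp : PolyTime p) (hc : PolyTime c) :
    PolyTime fun a => setColor (s a) (p a) (c a) :=
  hs.map (f := fun a (x : Cell) => if x.2.1 = p a then (c a, x.2) else x)
    (polyTime_ite_prop (id.snd.snd.fst.eq (hp.comp fst_apply))
      ((hc.comp fst_apply).pair id.snd.snd) id.snd)

theorem polyTime_cellLoad {k : α → ℕ} (hk : PolyTime k) (hs : PolyTime s) (hm : PolyTime m)
    (hc : PolyTime c) : PolyTime fun a => cellLoad (k a) (s a) (m a) (c a) :=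
  ((hs.filter (f := fun a (x : Cell) =>
      decide (x.1 = c a) && decide (x.2.1 < m a) && decide (k a ≤ x.2.1))
    (((id.snd.fst.eq (hc.comp fst_apply)).and (id.snd.snd.fst.lt (hm.comp fst_apply))).and
      ((hk.comp fst_apply).le id.snd.snd.fst))).map (f := fun _ (x : Cell) => x.2.2.2.1)
    id.snd.snd.snd.snd.fst).sum

theorem polyTime_validColors (hP : PolyTime P) (hm : PolyTime m) (hs : PolyTime s) :
    PolyTime fun a => validColors (P a) (m a) (s a) :=
  hP.snd.snd.filter (f := fun a c => validCells (P a) (m a) (setColor (s a) (m a) c))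
    (polyTime_validCells (hP.comp fst_apply) (hm.comp fst_apply)
      (polyTime_setColor (hs.comp fst_apply) (hm.comp fst_apply) id.snd))

theorem polyTime_bestColors (hP : PolyTime P) (hm : PolyTime m) (hs : PolyTime s) :
    PolyTime fun a => bestColors (P a) (m a) (s a) :=
  (polyTime_validColors hP hm hs).filter (f := fun a c => (validColors (P a) (m a) (s a)).all
      fun d => decide (cellLoad (P a).1 (s a) (m a) c ≤ cellLoad (P a).1 (s a) (m a) d))
    (((polyTime_validColors hP hm hs).comp fst_apply).all (f := fun (q : α × ℕ) d =>
      decide (cellLoad (P q.1).1 (s q.1) (m q.1) q.2 ≤ cellLoad (P q.1).1 (s q.1) (m q.1) d))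
      ((polyTime_cellLoad (hP.fst.comp id.fst.fst) (hs.comp id.fst.fst) (hm.comp id.fst.fst)
        id.fst.snd).le (polyTime_cellLoad (hP.fst.comp id.fst.fst) (hs.comp id.fst.fst)
          (hm.comp id.fst.fst) id.snd)))

theorem polyTime_swaps (hP : PolyTime P) (hm : PolyTime m) (hs : PolyTime s) :
    PolyTime fun a => swaps (P a) (m a) (s a) :=
  hP.snd.snd.flatMap (f := fun a c => ((s a).filter fun (u : Cell) => decide (u.2.1 < m a)).map
      fun (u : Cell) => setColor (setColor (s a) (m a) u.1) u.2.1 c)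
    (((hs.comp fst_apply).filter (f := fun (q : α × ℕ) (u : Cell) => decide (u.2.1 < m q.1))
      (id.snd.snd.fst.lt (hm.comp id.fst.fst))).map
      (f := fun (q : α × ℕ) (u : Cell) => setColor (setColor (s q.1) (m q.1) u.1) u.2.1 q.2)
      (polyTime_setColor
        (polyTime_setColor (hs.comp id.fst.fst) (hm.comp id.fst.fst) id.snd.fst)
        id.snd.snd.fst id.fst.snd))

theorem polyTime_stepCells (hP : PolyTime P) (hm : PolyTime m) (hs : PolyTime s) :
    PolyTime fun a => stepCells (P a) (m a) (s a) :=
  (((polyTime_bestColors hP hm hs).map (f := fun a c => setColor (s a) (m a) c)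
      (polyTime_setColor (hs.comp fst_apply) (hm.comp fst_apply) id.snd)).append
    ((polyTime_swaps hP hm hs).filter (f := fun a t => validCells (P a) (m a) t)
      (polyTime_validCells (hP.comp fst_apply) (hm.comp fst_apply) id.snd))).headD hs

/-- States that differ from `s₀` in the colors only, all of size at most `B`. -/
def Recoloring (B : ℕ) (s₀ s : List Cell) : Prop :=
  s.map Prod.snd = s₀.map Prod.snd ∧ ∀ x ∈ s, esize x.1 ≤ B

theorem Recoloring.setColor {B : ℕ} {s₀ s : List Cell} (h : Recoloring B s₀ s) {c : ℕ}
    (hc : esize c ≤ B) (p : ℕ) : Recoloring B s₀ (setColor s p c) := by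
  constructor
  · rw [← h.1, BlockGreedy.setColor, List.map_map]
    refine List.map_congr_left fun x _ => ?_
    simp only [Function.comp_apply]
    split <;> rfl
  · intro x hx
    obtain ⟨y, hy, rfl⟩ := List.mem_map.1 hx
    split
    · exact hc
    · exact h.2 y hy

/-- A step only writes colors from the list of colors or, in a swap, a color already present in the
state. -/
theorem Recoloring.stepCells {B : ℕ} {s₀ s : List Cell} (h : Recoloring B s₀ s) {P : Param}
    (hP : ∀ c ∈ P.2.2, esize c ≤ B) (m : ℕ) : Recoloring B s₀ (stepCells P m s) := by
  have key : ∀ t ∈ (bestColors P m s).map (BlockGreedy.setColor s m) ++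
      (swaps P m s).filter (validCells P m), Recoloring B s₀ t := by
    intro t ht
    rcases List.mem_append.1 ht with ht | ht
    · obtain ⟨c, hc, rfl⟩ := List.mem_map.1 ht
      exact h.setColor (hP c (List.mem_filter.1 (List.mem_filter.1 hc).1).1) m
    · obtain ⟨c, hc, ht⟩ := List.mem_flatMap.1 (List.mem_filter.1 ht).1
      obtain ⟨u, hu, rfl⟩ := List.mem_map.1 ht
      exact (h.setColor (h.2 u (List.mem_filter.1 hu).1) m).setColor (hP c hc) _
  rw [BlockGreedy.stepCells]
  revert key
  generalize (bestColors P m s).map (BlockGreedy.setColor s m) ++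
      (swaps P m s).filter (validCells P m) = L
  intro key
  cases L with
  | nil => exact h
  | cons t L => exact key t (by simp)

theorem Recoloring.esize_le {B : ℕ} {s₀ s : List Cell} (h : Recoloring B s₀ s) :
    esize s ≤ esize s₀ * (B + esize s₀ + 2) + 1 := by
  have hlen : s.length = s₀.length := by simpa using congrArg List.length h.1
  refine (esize_list_le (B := B + esize s₀ + 1) fun x hx => ?_).trans ?_
  · have h1 : x.2 ∈ s₀.map Prod.snd := h.1 ▸ List.mem_map_of_mem hx
    obtain ⟨y, hy, hyx⟩ := List.mem_map.1 h1
    have h2 := esize_le_of_mem hy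
    have h3 := h.2 x hx
    rw [esize_prod] at h2 ⊢
    rw [hyx] at h2
    omega
  · rw [hlen]
    exact Nat.add_le_add_right (Nat.mul_le_mul_right _ (length_le_esize _)) 1

/-- Every intermediate state is a `Recoloring` of the initial one with colors of bounded size, so
states stay polynomial however many steps are made. -/
theorem polyTime_runCells {l : α → List ℕ} (hP : PolyTime P) (hl : PolyTime l) (hs : PolyTime s) :
    PolyTime fun a => runCells (P a) (l a) (s a) := by
  obtain ⟨p, hp⟩ := hP.esize_le
  obtain ⟨q, hq⟩ := hs.esize_le
  refine foldl_of_bound (F := fun a s m => stepCells (P a) m s)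
    (polyTime_stepCells (hP.comp id.fst.fst) id.snd id.fst.snd) hs hl
    (q * (p + q + q + 2) + 1) fun a l _ => ?_
  have hrec : ∀ (l : List ℕ) (t : List Cell), Recoloring (esize (P a) + esize (s a)) (s a) t →
      Recoloring (esize (P a) + esize (s a)) (s a) (l.foldl (fun s m => stepCells (P a) m s) t) := by
    intro l
    induction l with
    | nil => exact fun t h => h
    | cons m l ih =>
      refine fun t h => ih _ (h.stepCells (fun c hc => ?_) m)
      have h1 := esize_le_of_mem hc
      rw [esize_prod (P a), esize_prod (P a).2]
      omega
  have h0 : Recoloring (esize (P a) + esize (s a)) (s a) (s a) := by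
    refine ⟨rfl, fun x hx => ?_⟩
    have h1 := esize_le_of_mem hx
    rw [esize_prod] at h1
    omega
  refine (hrec l _ h0).esize_le.trans ?_
  simp only [Polynomial.eval_add, Polynomial.eval_mul, Polynomial.eval_one, Polynomial.eval_ofNat]
  have h1 := hp a
  have h2 := hq a
  gcongr

theorem polyTime_sortDesc {l : α → List Vertex} (hl : PolyTime l) :
    PolyTime fun a => sortDesc (l a) := by
  have hle : PolyTime fun q : ((α × List Vertex) × Vertex) × Vertex =>
      decide (q.1.2.2.1 ≤ q.2.2.1) := id.fst.snd.snd.fst.le id.snd.snd.fst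
  refine foldr_of_growth (F := fun (_ : α) => insertDesc) ?_ const_nil hl (Polynomial.X + 1) ?_
  · exact (id.fst.snd.filter (f := fun (q : (α × List Vertex) × Vertex) b =>
      decide (q.2.2.1 ≤ b.2.1)) hle).append (id.snd.cons
        (id.fst.snd.filter (f := fun (q : (α × List Vertex) × Vertex) b =>
          !decide (q.2.2.1 ≤ b.2.1)) hle.not))
  · intro a s v
    have h1 := esize_append (s.filter fun b => decide (v.2.1 ≤ b.2.1))
      (v :: s.filter fun b => !decide (v.2.1 ≤ b.2.1))
    have h2 := esize_filter_add_le (fun b : Vertex => decide (v.2.1 ≤ b.2.1)) s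
    rw [esize_cons] at h1
    rw [insertDesc]
    simp only [Polynomial.eval_add, Polynomial.eval_X, Polynomial.eval_one]
    omega

theorem polyTime_output : PolyTime output := by
  have hM : PolyTime fun x : Input => x.2.1 := id.snd.fst
  have hW : PolyTime fun x : Input => x.2.2.1 := id.snd.snd.fst
  have hk : PolyTime fun x : Input => x.2.2.2.1 := id.snd.snd.snd.fst
  have hε : PolyTime fun x : Input => x.2.2.2.2.1 := id.snd.snd.snd.snd.fst
  have hr := hM.range_length
  have hn : PolyTime fun x : Input => x.2.1.length := by
    convert ((hM.map (f := fun _ _ => 1) (const_nat 1)).sum) using 2 with x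
    simp
  have hscaled : PolyTime fun x : Input => scaledWeights x.2.2.1 :=
    hW.map (f := fun (x : Input) (q : ℕ × ℕ) => q.1 * (x.2.2.1.map Prod.snd).prod / q.2)
      ((id.snd.fst.mul ((hW.comp fst_apply).map (f := fun _ (q : ℕ × ℕ) => q.2) id.snd.snd).prod).div
        id.snd.snd)
  have hvert : PolyTime vertexList :=
    hr.map (f := fun (x : Input) v => (v, (scaledWeights x.2.2.1).getD v 0, x.2.1.getD v []))
      (id.snd.pair (((hscaled.comp fst_apply).getD id.snd (const_nat 0)).pair
        ((hM.comp fst_apply).getD id.snd const_nil)))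
  have hparam : PolyTime param :=
    hk.pair (((hε.snd.div hε.fst).add (const_nat 1)).pair
      (hr.filter (f := fun (x : Input) c => decide (c < x.2.2.2.1)) (id.snd.lt (hk.comp fst_apply))))
  have hinit : PolyTime initCells :=
    hr.map (f := fun (x : Input) p => (0, p, (sortDesc (vertexList x)).getD p (0, 0, [])))
      ((const_nat 0).pair (id.snd.pair (((polyTime_sortDesc hvert).comp fst_apply).getD id.snd
        ((const_nat 0).pair ((const_nat 0).pair const_nil)))))
  have hfinal : PolyTime finalCells := polyTime_runCells hparam hr hinit
  refine polyTime_ite_prop (hn.le hk) hr (hr.map (f := fun (x : Input) v => colorOf (finalCells x) v) ?_)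
  exact (((hfinal.comp fst_apply).filter (f := fun (q : Input × ℕ) c => decide (c.2.2.1 = q.2))
    (id.snd.snd.snd.fst.eq id.fst.snd)).map (f := fun _ c => c.1) id.snd.fst).headD (const_nat 0)

end PolyTime

end BlockGreedy

/-! ### Correctness -/

namespace BlockGreedy

open CostModel

/-- The state of the program that represents the coloring `col`. -/
def cells {n : ℕ} (V : Fin n → Vertex) (col : Fin n → ℕ) : List Cell :=
  List.ofFn fun p => (col p, (p : ℕ), V p)

theorem sum_map_filter {β : Type} (p : β → Bool) (g : β → ℕ) (l : List β) :
    ((l.filter p).map g).sum = (l.map fun a => if p a then g a else 0).sum := by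
  induction l with
  | nil => rfl
  | cons a l ih => cases h : p a <;> simp [h, ih]

section Step

variable {n : ℕ} {G : SimpleGraph (Fin n)} {k T : ℕ} {V : Fin n → Vertex} {col : Fin n → ℕ}

theorem setColor_cells (p : Fin n) (c : ℕ) :
    setColor (cells V col) p c = cells V (Function.update col p c) := by
  rw [setColor, cells, List.map_ofFn, cells]
  congr 1
  funext q
  by_cases h : q = p
  · simp [h]
  · have : (q : ℕ) ≠ p := fun h' => h (Fin.ext h')
    simp [h, this]

theorem cellLoad_cells (m c : ℕ) :
    cellLoad k (cells V col) m c = load (fun p => (V p).2.1) k col m c := by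
  rw [cellLoad, sum_map_filter, cells, List.map_ofFn, List.sum_ofFn, load, Finset.sum_filter]
  refine Finset.sum_congr rfl fun a _ => ?_
  simp [and_assoc]

theorem validCells_cells (hadj : ∀ p q, 1 ≤ (V p).2.2.getD (V q).1 0 ↔ G.Adj p q) (C : List ℕ)
    (m : ℕ) : validCells (k, T, C) m (cells V col) = true ↔ Valid G k T col (m + 1) := by
  simp only [validCells, cells, List.all_eq_true, List.forall_mem_ofFn_iff, compatible, adjacent,
    hadj, Valid, Nat.lt_succ_iff, ne_eq, Fin.ext_iff, Bool.or_eq_true, Bool.and_eq_true,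
    Bool.not_eq_true', Bool.not_eq_false', Bool.and_eq_false_iff, decide_eq_true_eq,
    decide_eq_false_iff_not]
  refine forall_congr' fun a => forall_congr' fun b => ?_
  tauto

/-- `Step` leaves ties open and the program takes the first candidate. The candidate list is
nonempty by `hex`, and a swap heads it only if no valid color exists. -/
theorem stepCells_cells (hadj : ∀ p q, 1 ≤ (V p).2.2.getD (V q).1 0 ↔ G.Adj p q) (m : Fin n)
    (hex : ∃ col', Step G (fun p => (V p).2.1) k T m col col') :
    ∃ col', stepCells (k, T, List.range k) m (cells V col) = cells V col' ∧
      Step G (fun p => (V p).2.1) k T m col col' := by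
  have hvalid : ∀ c, c ∈ validColors (k, T, List.range k) m (cells V col) ↔
      c < k ∧ Valid G k T (Function.update col m c) (m + 1) := fun c => by
    rw [validColors, List.mem_filter, List.mem_range, setColor_cells, validCells_cells hadj]
  have hbest : ∀ c, c ∈ bestColors (k, T, List.range k) m (cells V col) ↔
      (c < k ∧ Valid G k T (Function.update col m c) (m + 1)) ∧
        ∀ d < k, Valid G k T (Function.update col m d) (m + 1) →
          load (fun p => (V p).2.1) k col m c ≤ load (fun p => (V p).2.1) k col m d := fun c => by
    rw [bestColors, List.mem_filter, hvalid, List.all_eq_true]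
    simp only [hvalid, cellLoad_cells, decide_eq_true_eq, and_imp]
  have hswaps : ∀ t, t ∈ (swaps (k, T, List.range k) m (cells V col)).filter
      (validCells (k, T, List.range k) m) ↔ ∃ c < k, ∃ u < m,
        Valid G k T (swap col m u c) (m + 1) ∧ t = cells V (swap col m u c) := fun t => by
    simp only [swaps, List.mem_filter, List.mem_flatMap, List.mem_range, List.mem_map]
    constructor
    · rintro ⟨⟨c, hc, u, ⟨hu, hum⟩, rfl⟩, hval⟩
      obtain ⟨u, rfl⟩ := (List.mem_ofFn' _ _).1 hu
      simp only [setColor_cells, validCells_cells hadj] at hval ⊢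
      exact ⟨c, hc, u, by simpa using hum, hval, rfl⟩
    · rintro ⟨c, hc, u, hum, hval, rfl⟩
      refine ⟨⟨c, hc, _, ⟨(List.mem_ofFn' _ _).2 ⟨u, rfl⟩, by simpa using hum⟩, ?_⟩, ?_⟩
      · simp only [setColor_cells, swap]
      · rwa [validCells_cells hadj]
  have key : ∀ t ∈ (bestColors (k, T, List.range k) m (cells V col)).map
      (setColor (cells V col) m), ∃ col', t = cells V col' ∧
        Step G (fun p => (V p).2.1) k T m col col' := by
    intro t ht
    obtain ⟨c, hc, rfl⟩ := List.mem_map.1 ht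
    obtain ⟨⟨hck, hval⟩, hmin⟩ := (hbest c).1 hc
    exact ⟨_, setColor_cells m c, Or.inl ⟨c, hck, hval, hmin, rfl⟩⟩
  rw [stepCells]
  cases hL : (bestColors (k, T, List.range k) m (cells V col)).map (setColor (cells V col) m) with
  | cons t L =>
    rw [hL] at key
    exact key t (by simp)
  | nil =>
    rw [List.map_eq_nil_iff] at hL
    obtain ⟨col', hcol'⟩ := hex
    rcases hcol' with ⟨c, hc, hval, hmin, -⟩ | ⟨hno, c, hc, u, hu, hval, -⟩
    · have := (hbest c).2 ⟨⟨hc, hval⟩, hmin⟩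
      rw [hL] at this
      simp at this
    · have hmem := (hswaps _).2 ⟨c, hc, u, hu, hval, rfl⟩
      rw [List.nil_append]
      cases hS : (swaps (k, T, List.range k) m (cells V col)).filter
          (validCells (k, T, List.range k) m) with
      | nil => rw [hS] at hmem; simp at hmem
      | cons t L =>
        obtain ⟨c, hc, u, hu, hval, rfl⟩ := (hswaps t).1 (by rw [hS]; simp)
        exact ⟨_, rfl, Or.inr ⟨hno, c, hc, u, hu, hval, rfl⟩⟩

theorem runCells_cells {D : ℕ} (hadj : ∀ p q, 1 ≤ (V p).2.2.getD (V q).1 0 ↔ G.Adj p q)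
    (hw : Antitone fun p => (V p).2.1)
    (hD : ∀ v (s : Finset (Fin n)), (∀ u ∈ s, G.Adj v u) → s.card ≤ D) (hT : 0 < T)
    (hk : (T + 1) * D < k) (m : ℕ) (hm : m ≤ n) :
    ∃ col', runCells (k, T, List.range k) (List.range m) (cells V fun _ => 0) = cells V col' ∧
      Inv G (fun p => (V p).2.1) k T D col' m := by
  induction m with
  | zero => exact ⟨_, rfl, .zero hw⟩
  | succ m ih =>
    obtain ⟨col', hrun, hinv⟩ := ih (by omega)
    obtain ⟨col'', hstep, hcol''⟩ := stepCells_cells hadj ⟨m, hm⟩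
      (exists_step (m := ⟨m, hm⟩) _ hD hk hinv.valid)
    refine ⟨col'', ?_, hinv.step hw hD hT hk hcol''⟩
    rw [runCells, List.range_succ, List.foldl_append]
    change stepCells _ m (runCells _ (List.range m) _) = _
    rw [hrun]
    exact hstep

end Step

theorem insertDesc_perm (a : Vertex) (l : List Vertex) : (insertDesc a l).Perm (a :: l) := by
  rw [insertDesc]
  refine List.perm_middle.trans (List.Perm.cons a ?_)
  exact List.filter_append_perm _ l

theorem sortDesc_perm (l : List Vertex) : (sortDesc l).Perm l := by
  induction l with
  | nil => exact .nil
  | cons a l ih => exact (insertDesc_perm a _).trans (ih.cons a)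

theorem sortDesc_pairwise (l : List Vertex) :
    (sortDesc l).Pairwise fun a b => b.2.1 ≤ a.2.1 := by
  induction l with
  | nil => exact .nil
  | cons a l ih =>
    change (insertDesc a (sortDesc l)).Pairwise _
    rw [insertDesc, List.pairwise_append, List.pairwise_cons]
    refine ⟨ih.filter _, ⟨fun b hb => ?_, ih.filter _⟩, fun b hb c hc => ?_⟩
    · have := (List.mem_filter.1 hb).2
      simp only [Bool.not_eq_true', decide_eq_false_iff_not] at this
      omega
    · have h1 := (List.mem_filter.1 hb).2
      rw [decide_eq_true_eq] at h1
      rcases List.mem_cons.1 hc with rfl | hc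
      · exact h1
      · have h2 := (List.mem_filter.1 hc).2
        simp only [Bool.not_eq_true', decide_eq_false_iff_not] at h2
        omega

/-- Turns the sorted list of vertices into a permutation of indices. Equal weights do no harm,
because the entries carry the vertex numbers and are distinct. -/
theorem exists_equiv_of_perm_ofFn {β : Type} {n : ℕ} {E : Fin n → β} (hE : Function.Injective E)
    {l : List β} (h : l.Perm (List.ofFn E)) : ∃ σ : Fin n ≃ Fin n, l = List.ofFn (E ∘ σ) := by
  have hlen : l.length = n := by rw [h.length_eq, List.length_ofFn]
  have hnodup : l.Nodup := h.nodup_iff.2 (List.nodup_ofFn.2 hE)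
  have hex : ∀ p : Fin n, ∃ v, E v = l[(p : ℕ)]'(by omega) := fun p => by
    have := h.mem_iff.1 (List.getElem_mem (l := l) (n := p) (by omega))
    exact (List.mem_ofFn' _ _).1 this
  choose f hf using hex
  have hinj : Function.Injective f := fun p q hpq => by
    have h1 : l[(p : ℕ)]'(by omega) = l[(q : ℕ)]'(by omega) := by rw [← hf, ← hf, hpq]
    exact Fin.ext ((hnodup.getElem_inj_iff).1 h1)
  refine ⟨Equiv.ofBijective f (Finite.injective_iff_bijective.1 hinj), ?_⟩
  refine List.ext_getElem (by rw [hlen, List.length_ofFn]) fun i h1 h2 => ?_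
  rw [List.getElem_ofFn]
  exact (hf ⟨i, by omega⟩).symm

theorem colorOf_cells {n : ℕ} {V : Fin n → Vertex} {σ : Fin n ≃ Fin n}
    (hV : ∀ p, (V p).1 = (σ p : ℕ)) (col : Fin n → ℕ) (p : Fin n) :
    colorOf (cells V col) (σ p) = col p := by
  have hmem : ∀ c ∈ ((cells V col).filter fun c => decide (c.2.2.1 = (σ p : ℕ))).map Prod.fst,
      c = col p := by
    intro c hc
    obtain ⟨x, hx, rfl⟩ := List.mem_map.1 hc
    obtain ⟨hx1, hx2⟩ := List.mem_filter.1 hx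
    obtain ⟨q, rfl⟩ := (List.mem_ofFn' _ _).1 hx1
    simp only [hV, decide_eq_true_eq] at hx2
    rw [σ.injective (Fin.ext hx2)]
  have hex : col p ∈ ((cells V col).filter fun c => decide (c.2.2.1 = (σ p : ℕ))).map Prod.fst :=
    List.mem_map.2 ⟨(col p, (p : ℕ), V p), List.mem_filter.2
      ⟨(List.mem_ofFn' _ _).2 ⟨p, rfl⟩, by simp [hV]⟩, rfl⟩
  rw [colorOf]
  revert hmem hex
  generalize ((cells V col).filter fun c => decide (c.2.2.1 = (σ p : ℕ))).map Prod.fst = L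
  intro hmem hex
  cases L with
  | nil => simp at hex
  | cons c L => exact hmem c (by simp)

/-! ### Encoding of instances and correctness of the output -/

section Input

variable {n : ℕ} (G : SimpleGraph (Fin n)) [DecidableRel G.Adj] (w : Fin n → ℚ) (k : ℕ) (ε : ℚ)

/-- The row of vertex `v` in the adjacency matrix. -/
def adjRow (v : Fin n) : List ℕ := List.ofFn fun u => if G.Adj v u then 1 else 0

/-- The instance as an input of the program. -/
def toInput : Input :=
  (n, List.ofFn (adjRow G), List.ofFn (fun v => ((w v).num.toNat, (w v).den)), k,
    (ε.num.toNat, ε.den), ())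

theorem enc_ofFn {β : Type} [Enc β] (f : Fin n → β) :
    Enc.enc (List.ofFn f) = encodeFun fun v => Enc.enc (f v) := by
  change Data.ofList ((List.ofFn f).map Enc.enc) = _
  rw [List.map_ofFn]
  rfl

/-- The final `()` of the tuple is encoded as `0`, the empty list, so nested pairs give the same
data as the list in `encodeInstance`. -/
theorem enc_toInput : Enc.enc (toInput G w k ε) = encodeInstance G w k ε := by
  simp only [toInput, enc_pair, enc_ofFn, adjRow]
  have h : ∀ u v : Fin n, Enc.enc (if G.Adj u v then 1 else 0 : ℕ) =
      if G.Adj u v then Data.num 1 else Data.num 0 := fun u v => by split <;> rfl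
  simp only [h]
  rfl

/-- Vertex `v` as it occurs in the program. -/
def vertex (v : Fin n) : Vertex := ((v : ℕ), natWeight w v, adjRow G v)

theorem map_range_eq_ofFn {β : Type} (f : ℕ → β) :
    (List.range n).map f = List.ofFn fun v : Fin n => f v := by
  refine List.ext_getElem (by simp) fun i h1 h2 => ?_
  simp

theorem getD_ofFn {β : Type} (f : Fin n → β) (v : Fin n) (d : β) :
    (List.ofFn f).getD v d = f v := by
  simp [List.getD_eq_getElem?_getD]

theorem vertexList_toInput : vertexList (toInput G w k ε) = List.ofFn (vertex G w) := by
  have hscaled : scaledWeights (toInput G w k ε).2.2.1 = List.ofFn (natWeight w) := by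
    rw [scaledWeights, toInput]
    simp only [List.map_ofFn, List.prod_ofFn]
    rfl
  rw [vertexList, hscaled]
  simp only [toInput, List.length_ofFn, map_range_eq_ofFn, getD_ofFn]
  rfl

/-- The program uses T = ⌊1/ε⌋ + 1, obtained by one integer division. The lower bound serves
`ratio_le`, the upper one `mul_lt_of_color_bound`. -/
theorem natFloor_bounds (hε : 0 < ε) :
    1 / (ε : ℝ) ≤ (ε.den / ε.num.toNat + 1 : ℕ) ∧
      ((ε.den / ε.num.toNat + 1 : ℕ) : ℝ) ≤ 1 / (ε : ℝ) + 1 := by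
  have hnum : 0 < ε.num.toNat := by
    have := Rat.num_pos.2 hε
    omega
  have h1 : 1 / (ε : ℝ) = (ε.den : ℝ) / (ε.num.toNat : ℝ) := by
    have h2 : ((ε.num.toNat : ℕ) : ℝ) = ((ε.num : ℤ) : ℝ) := by
      have := Int.toNat_of_nonneg (Rat.num_nonneg.2 hε.le)
      exact_mod_cast congrArg (Int.cast : ℤ → ℝ) this
    rw [h2, Rat.cast_def, one_div_div]
  rw [h1, ← Nat.floor_div_eq_div (K := ℝ), Nat.cast_add, Nat.cast_one]
  exact ⟨(Nat.lt_floor_add_one _).le,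
    add_le_add_left (Nat.floor_le (by positivity)) 1⟩

end Input

theorem output_toInput {n : ℕ} (G : SimpleGraph (Fin n)) [DecidableRel G.Adj] (w : Fin n → ℚ)
    (ε : ℚ) (k : ℕ) (hw : ∀ v, 0 ≤ w v) (hε : 0 < ε) (hε1 : ε ≤ 1 / 10) (hk : 1 ≤ k)
    (h : 4 * (1 + (ε : ℝ)) ^ 2 / (ε : ℝ) ^ 2 * (Real.log (1 / (ε : ℝ)) + 4) * (G.maxDegree : ℝ)
      ≤ (k : ℝ)) :
    ∃ c : G.Coloring (Fin k), output (toInput G w k ε) = List.ofFn (fun v => (c v : ℕ)) ∧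
      WeightedColoring.IsEQ1 w (1 + 3 * (ε : ℝ)) c := by
  have hεR : (0 : ℝ) < ε := Rat.cast_pos.2 hε
  have hlen : (toInput G w k ε).2.1.length = n := by simp [toInput]
  have hk' : (toInput G w k ε).2.2.2.1 = k := rfl
  rw [output, hlen, hk']
  split_ifs with hnk
  -- With n ≤ k all vertices get different colors, and no list of k colors is needed.
  · let c : G.Coloring (Fin k) := SimpleGraph.Coloring.mk (Fin.castLE hnk) fun {u v} huv h' =>
      huv.ne (Fin.castLE_injective hnk h')
    refine ⟨c, ?_, isEQ1_of_injective hw (by positivity) c (Fin.castLE_injective hnk)⟩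
    have := map_range_eq_ofFn (n := n) fun v => v
    rw [List.map_id'] at this
    exact this
  have hε1R : (ε : ℝ) ≤ 1 / 10 := by
    have := (Rat.cast_le (K := ℝ)).2 hε1
    push_cast at this
    exact this
  have hb := color_bound hεR hε1R h
  obtain ⟨hT1, hT2⟩ := natFloor_bounds ε hε
  set T := ε.den / ε.num.toNat + 1 with hTdef
  have hT0 : 0 < T := Nat.succ_pos _
  have hTk := mul_lt_of_color_bound hεR hε1R hk hb hT2
  have hinj : Function.Injective (vertex G w) := fun u v huv => Fin.ext (congrArg Prod.fst huv)
  obtain ⟨σ, hσ⟩ := exists_equiv_of_perm_ofFn hinj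
    ((sortDesc_perm (vertexList (toInput G w k ε))).trans (by rw [vertexList_toInput]))
  have hinit : initCells (toInput G w k ε) = cells (vertex G w ∘ σ) fun _ => 0 := by
    rw [initCells, hlen, hσ, map_range_eq_ofFn, cells]
    simp only [getD_ofFn]
  have hparam : param (toInput G w k ε) = (k, T, List.range k) := by
    rw [param, hlen, hk']
    refine Prod.ext rfl (Prod.ext rfl ?_)
    change (List.range n).filter (fun c => decide (c < k)) = List.range k
    -- Here k < n, so filtering the range of n yields all k colors, in a list no longer than the
    -- number of vertices.
    rw [show n = k + (n - k) by omega, List.range_add, List.filter_append,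
      List.filter_eq_self.2 (by simp), List.filter_eq_nil_iff.2 (by simp), List.append_nil]
  have hanti : Antitone fun p => ((vertex G w ∘ σ) p).2.1 := by
    have hpw := sortDesc_pairwise (vertexList (toInput G w k ε))
    rw [hσ, List.pairwise_ofFn] at hpw
    intro a b hab
    rcases hab.eq_or_lt with rfl | hab
    · exact le_rfl
    · exact hpw hab
  have hadj : ∀ p q, 1 ≤ ((vertex G w ∘ σ) p).2.2.getD ((vertex G w ∘ σ) q).1 0 ↔
      (G.comap σ).Adj p q := fun p q => by
    simp only [Function.comp_apply, vertex, adjRow, getD_ofFn, SimpleGraph.comap_adj]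
    split <;> simp [*]
  obtain ⟨col, hrun, hinv⟩ := runCells_cells hadj hanti (card_le_of_adj (G := G) σ) hT0 hTk n le_rfl
  obtain ⟨c, hc, hcol⟩ := exists_isEQ1_of_inv
    (Finset.prod_pos fun u _ => (w u).den_pos : 0 < ∏ u, (w u).den)
    (lt_of_le_of_lt (Nat.le_mul_of_pos_left _ (by omega)) hTk) hT0 σ
    (fun p => natWeight_cast hw (σ p)) hinv (ratio_le hεR hε1R hb hT1)
  refine ⟨c, ?_, hc⟩
  rw [finalCells, hlen, hinit, hparam, hrun, map_range_eq_ofFn]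
  congr 1
  funext v
  obtain ⟨p, rfl⟩ := σ.surjective v
  rw [hcol, colorOf_cells fun _ => rfl]

end BlockGreedy

theorem mainTheorem1 :
    -- existence, for real `ε`
    (∀ (V : Type*) [Fintype V] [DecidableEq V] (G : SimpleGraph V) [DecidableRel G.Adj]
        (w : V → ℚ) (ε : ℝ) (k : ℕ),
        (∀ v, 0 ≤ w v) → 0 < ε → ε ≤ 1 / 10 → 1 ≤ k →
        4 * (1 + ε) ^ 2 / ε ^ 2 * (Real.log (1 / ε) + 4) * (G.maxDegree : ℝ) ≤ (k : ℝ) →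
        ∃ c : G.Coloring (Fin k), WeightedColoring.IsEQ1 w (1 + 3 * ε) c) ∧
    -- one program and one polynomial, for all instances
    (∃ (p : CostModel.Prog) (P : Polynomial ℕ),
      ∀ (n : ℕ) (G : SimpleGraph (Fin n)) [DecidableRel G.Adj]
        (w : Fin n → ℚ) (ε : ℚ) (k : ℕ),
        (∀ v, 0 ≤ w v) → 0 < ε → ε ≤ 1 / 10 → 1 ≤ k →
        4 * (1 + (ε : ℝ)) ^ 2 / (ε : ℝ) ^ 2 * (Real.log (1 / (ε : ℝ)) + 4) * (G.maxDegree : ℝ)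
          ≤ (k : ℝ) →
        ∃ (c : G.Coloring (Fin k)) (t : ℕ),
          CostModel.Runs p (CostModel.encodeInstance G w k ε) (CostModel.encodeColoring c) t ∧
          t ≤ P.eval (CostModel.encodeInstance G w k ε).size ∧
          WeightedColoring.IsEQ1 w (1 + 3 * (ε : ℝ)) c) := by
  refine ⟨fun V _ _ G _ w ε k => BlockGreedy.exists_isEQ1 G w ε k, ?_⟩
  obtain ⟨p, P, hp⟩ := BlockGreedy.polyTime_output
  refine ⟨p, P, fun n G _ w ε k hw hε hε1 hk h => ?_⟩
  obtain ⟨c, hout, hc⟩ := BlockGreedy.output_toInput G w ε k hw hε hε1 hk h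
  obtain ⟨t, ht, hle⟩ := hp (BlockGreedy.toInput G w k ε)
  rw [CostModel.esize, BlockGreedy.enc_toInput] at hle
  rw [BlockGreedy.enc_toInput, hout, BlockGreedy.enc_ofFn] at ht
  exact ⟨c, t, ht, hle, hc⟩
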